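/- **Setting.** Let $\mathrm{Loc}$ be a set of locations and $V$ a set of values. A *pomset* over $L$ is a strict poset $(P,<_P)$ of occurrences with a labelling $\Phi_P:P\to L$, taken up to label-preserving order isomorphism. $P\parallel Q$ is the disjoint union; $P;Q$ in addition puts all of $P$ below all of $Q$ (and $P;Q=P$ if $P$ is infinite). Program-order actions $\mathcal A_{PO}$ are global writes $x:=v$, reads $x=v$, and the skip $\delta$; TSO actions $\mathcal A_{TSO}$ are these and the buffer writes $\bar x:=v$. **Program orders.** Programs are the commands $c::=\mathbf{skip}\mid x:=e\mid c;c\mid c\parallel c\mid \mathbf{if}\,b\,\mathbf{then}\,c\,\mathbf{else}\,c\mid\mathbf{while}\,b\,\mathbf{do}\,c$ over value and boolean expressions built from constants, locations and operators. $\mathcal P_{PO}$ is defined by recursion: constants and $\mathbf{skip}$ give $\{\delta\}$; an expression $x$ gives $\{x=v\}$ with value $v$, for every $v\in V$; a binary operator gives $P_1\parallel P_2$ and the value computed from the values of the operands; unary operators keep the pomset; $x:=e$ gives $P;\{x:=v\}$ where $e$ gives $P$ with value $v$; $c_1;c_2$ and $c_1\parallel c_2$ are composed accordingly; a conditional gives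 a pomset of $b$ with value true followed by one of the first branch, or one with value false followed by one of the second; a loop gives all finite and infinite unrollings. Program orders are identified when deleting finitely many $\delta$ from each yields the same non-empty pomset; $\mathcal P_{PO}(p)$ contains every representative. **TSO-consistency.** A strict partial order $<_T$ on the occurrences of $P$ is *TSO-consistent* with $P$ if, for some finite partial function $\sigma:\mathrm{Loc}\rightharpoonup V$ (with $\downarrow_< s=\{s'\mid s'<s\}\cup\{s\}$): (O) $<_T$ totally orders the writes of $P$; (V) for each read $r=(x=v)$, either (a) some write $w=(x:=v)$ is $<_T$-maximal among the writes to $x$ in $\downarrow_T r$, and all writes to $x$ in $\downarrow_P r$ lie in $\downarrow_T w$; or (b) some write $w=(x:=v)$ is $<_P$-maximal among the writes to $x$ in $\downarrow_P r$, and $r<_T w$; or (c) there is no write to $x$ in $\downarrow_T r$ or $\downarrow_P r$, and $\sigma(x)=v$; (L) $r<_P a$ implies $r<_T a$ for each read $r$ and each $a$; (S) $w<_P w'$ implies $w<_T w'$ for writes $w,w'$; (F) if $a_1<_P a_2$, $a_1<_P a_3$ and $a_2,a_3$ are incomparable in $P$, then $a_1<_T a_2$ and $a_1<_T a_3$; (J)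 if $a_1<_P a_3$, $a_2<_P a_3$ and $a_1,a_2$ are incomparable in $P$, then $a_1<_T a_3$ and $a_2<_T a_3$. **Footprints.** A buffered state is a pair of finite partial functions, one assigning to buffer locations $\bar x$ values $v_n$ ($v\in V$, $n\in\mathbb N$, all $v_0$ being identified) and one assigning to locations $x$ values in $V$. $\zeta(\sigma)$ means that every buffer location in the domain has a value $v_0$. Write $[\sigma\mid\tau]$ for $\sigma$ overwritten by $\tau$, and $\sigma\Uparrow\tau$ if $\sigma,\tau$ agree on their common domain. Footsteps are pairs of states, with $(\sigma_1,\tau_1)\lhd(\sigma_2,\tau_2)=(\sigma_1\cup(\sigma_2\setminus\mathrm{dom}\,\tau_1),[\tau_1\mid\tau_2])$, defined if $[\sigma_1\mid\tau_1]\Uparrow\sigma_2$, and lifted to sets. The footprints of actions, for all $v',v''\in V$ and $n\in\mathbb N$, are: for $x=v$, $([x:v,\bar x:v_0],[\,])$ and $([\bar x:v_{n+1}],[\,])$; for $\bar x:=v$, $([\bar x:v'_n],[\bar x:v_{n+1}])$; for $x:=v$, $([x:v',\bar x:v''_{n+1}],[x:v,\bar x:v''_n])$; for $\delta$, $([\,],[\,])$.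 For a list $E$ of global writes, $[\![E]\!]^*$ is the $\lhd$-composition in order of the sets $\{([x:v'],[x:v])\mid v'\in V\}$ for its entries $x:=v$ (and $\{([\,],[\,])\}$ for the empty list). For a list $\Lambda$ that is a linearisation of a pomset $P$ over $\mathcal A_{TSO}$ interspersed with foreign global writes, $[\![P]\!]_\Lambda$ is the least set such that: (Act) if $P=\{\lambda\}$ and $\Lambda=\Lambda_1;\lambda;\Lambda_2$, it contains $[\![\Lambda_1]\!]^*\lhd[\![\lambda]\!]\lhd[\![\Lambda_2]\!]^*$; (Seq) if $P=P_1;P_2$ and $\Lambda=\Lambda_1;\Lambda_2$, it contains $[\![P_1]\!]_{\Lambda_1}\lhd[\![P_2]\!]_{\Lambda_2}$; (Par) if $P=P_1\parallel P_2$, $\Lambda_i$ arises from $\Lambda$ by deleting the actions of the other component other than its global writes (which become foreign), $(\sigma_i,\tau_i)\in[\![P_i]\!]_{\Lambda_i}$, $\zeta(\sigma_i)$, $\zeta(\tau_i)$ for $i=1,2$, and $\sigma_1\Uparrow\sigma_2$, it contains $(\sigma_1\cup\sigma_2,\tau_1\cup\tau_2)$. **Well-balanced pomsets and $U$.** A linear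 segment of a pomset is a chain of occurrences such that every occurrence outside it stands in the same order relation to all its elements; the SP components are the maximal linear segments. A pomset $P'$ over $\mathcal A_{TSO}$ is *well-balanced* if it is series-parallel (obtained from linear pomsets by sequential and parallel composition) and there is a bijection $\omega$ from its buffer writes to its global writes that maps the buffer writes of each SP component order-isomorphically onto the global writes of the same component, sends each $\bar x:=v$ to an occurrence of $x:=v$, and satisfies $b<_{P'}\omega(b)$. $U(P')$ is obtained from $P'$ by deleting the global writes and relabelling each $\bar x:=v$ as $x:=v$; its reads and skips are identified with those of $P'$, and the write that comes from a buffer write $b$ is identified with $\omega(b)$. **Theorem (soundness of $\mathcal T$).** For a pomset $P$ over $\mathcal A_{PO}$ let $$\mathcal T(P)=\bigcup_{P'\text{ well-balanced},\,U(P')=P}\{\Lambda{\restriction}_{\mathcal A_{PO}}\mid\Lambda\text{ a linearisation of }P',\ \exists(\sigma,\tau)\in[\![P']\!]_\Lambda:\ \zeta(\sigma)\wedge\zeta(\tau)\},$$ where $\Lambda{\restriction}_{\mathcal A_{PO}}$ is read as a list of the occurrences of $P$ through the above identification. Then for every program $p$, every finite $P\in\mathcal P_{PO}(p)$ and every $L\in\mathcal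 T(P)$, the list $L$ enumerates the occurrences of $P$ without repetition, and the total order it defines is TSO-consistent with $P$. -/

import Mathlib

namespace TSO

/-! ### Pomsets -/

/-- A (strict) partially ordered multiset over the label set `L`: a strict poset of action
occurrences together with a labelling. -/
structure Pom (L : Type*) where
  Occ : Type
  lt : Occ → Occ → Prop
  irrefl : ∀ a, ¬ lt a a
  trans : ∀ a b c, lt a b → lt b c → lt a c
  label : Occ → L

namespace Pom

variable {L : Type*}

/-- Isomorphisms of pomsets: label-preserving order isomorphisms. -/
structure Iso (P Q : Pom L) where
  toEquiv : P.Occ ≃ Q.Occ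
  lt_iff : ∀ a b, Q.lt (toEquiv a) (toEquiv b) ↔ P.lt a b
  label_eq : ∀ a, Q.label (toEquiv a) = P.label a

/-- The one-element pomset `{l}`. -/
def single (l : L) : Pom L where
  Occ := Unit
  lt := fun _ _ => False
  irrefl := fun _ h => h
  trans := fun _ _ _ h _ => h
  label := fun _ => l

/-- The sub-pomset on a set of occurrences, with the induced order. -/
def restrict (P : Pom L) (A : Set P.Occ) : Pom L where
  Occ := A
  lt := fun a b => P.lt a b
  irrefl := fun a => P.irrefl a
  trans := fun a b c => P.trans a b c
  label := fun a => P.label a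

/-- Parallel composition: disjoint union, without further ordering. -/
def par (P Q : Pom L) : Pom L where
  Occ := P.Occ ⊕ Q.Occ
  lt := Sum.LiftRel P.lt Q.lt
  irrefl := by
    rintro (a | a) h
    · exact P.irrefl a (by simpa using h)
    · exact Q.irrefl a (by simpa using h)
  trans := by
    rintro (a | a) (b | b) (c | c) h h' <;> simp at h h' ⊢
    · exact P.trans _ _ _ h h'
    · exact Q.trans _ _ _ h h'
  label := Sum.elim P.label Q.label

/-- Disjoint union with every occurrence of `P` below every occurrence of `Q`. -/
def ordSum (P Q : Pom L) : Pom L where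
  Occ := P.Occ ⊕ Q.Occ
  lt := Sum.Lex P.lt Q.lt
  irrefl := by
    rintro (a | a) h
    · exact P.irrefl a (by simpa using h)
    · exact Q.irrefl a (by simpa using h)
  trans := by
    rintro (a | a) (b | b) (c | c) h h' <;> simp at h h' ⊢
    · exact P.trans _ _ _ h h'
    · exact Q.trans _ _ _ h h'
  label := Sum.elim P.label Q.label

open Classical in
/-- Sequential composition `P;Q`; it is `P` when `P` is infinite. -/
noncomputable def seq (P Q : Pom L) : Pom L :=
  if Finite P.Occ then ordSum P Q else P

/-- The sequential composition `R 0; R 1; R 2; ⋯` of a sequence of pomsets. As in the binary case,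
whatever follows an infinite pomset is dropped. -/
def seqOmega (R : ℕ → Pom L) : Pom L where
  Occ := {x : Σ n, (R n).Occ // ∀ m < x.1, Finite (R m).Occ}
  lt := fun x y => Sigma.Lex (· < ·) (fun n => (R n).lt) x.1 y.1
  irrefl := by
    rintro ⟨⟨n, a⟩, _⟩ h
    rcases (Sigma.lex_iff.1 h) with h | ⟨_, h⟩
    · exact lt_irrefl _ h
    · exact (R n).irrefl a h
  trans := by
    rintro ⟨⟨n, a⟩, _⟩ ⟨⟨m, b⟩, _⟩ ⟨⟨k, c⟩, _⟩ h h'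
    simp only at h h' ⊢
    cases h with
    | left _ _ h =>
      cases h' with
      | left _ _ h' => exact Sigma.Lex.left _ _ (lt_trans h h')
      | right _ _ h' => exact Sigma.Lex.left _ _ h
    | right _ _ h =>
      cases h' with
      | left _ _ h' => exact Sigma.Lex.left _ _ h'
      | right _ _ h' => exact Sigma.Lex.right _ _ ((R _).trans _ _ _ h h')
  label := fun x => (R x.1.1).label x.1.2

/-- `Precedes Λ a b`: `a` occurs before `b` in the list `Λ`. For a list without repetitions this is
the strict total order on its elements that the list stands for. -/
def Precedes {α : Type*} (Λ : List α) (a b : α) : Prop := List.Sublist [a, b] Λ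

/-- `Λ` lists every element of `α` exactly once, so it stands for a total order on `α`. -/
def Enumerates {α : Type*} (Λ : List α) : Prop := Λ.Nodup ∧ ∀ a, a ∈ Λ

/-- The set of linearisations of a (finite) pomset. -/
def Lin (P : Pom L) : Set (List P.Occ) :=
  {Λ | Enumerates Λ ∧ ∀ a b, P.lt a b → Precedes Λ a b}

/-- Two distinct occurrences are incomparable. -/
def Incomp (P : Pom L) (a b : P.Occ) : Prop := a ≠ b ∧ ¬ P.lt a b ∧ ¬ P.lt b a

/-- `A` is a chain of `P`. -/
def IsLinear (P : Pom L) (A : Set P.Occ) : Prop :=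
  ∀ a ∈ A, ∀ b ∈ A, a ≠ b → P.lt a b ∨ P.lt b a

/-- `P` restricted to `A` is series-parallel: it is linear, or it is the sequential or the parallel
composition of series-parallel pomsets. (For an infinite first component a sequential composition
is that component.) -/
inductive IsSPOn (P : Pom L) : Set P.Occ → Prop
  | linear (A : Set P.Occ) : P.IsLinear A → IsSPOn P A
  | seq (A B : Set P.Occ) : IsSPOn P A → IsSPOn P B → A.Finite →
      (∀ a ∈ A, ∀ b ∈ B, P.lt a b) → IsSPOn P (A ∪ B)
  | par (A B : Set P.Occ) : IsSPOn P A → IsSPOn P B →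
      (∀ a ∈ A, ∀ b ∈ B, P.Incomp a b) → IsSPOn P (A ∪ B)

/-- A pomset is series-parallel. -/
def IsSP (P : Pom L) : Prop := P.IsSPOn Set.univ

/-- A linear segment: a chain all of whose elements are related in the same way to each occurrence
outside of it. -/
def IsLinearSegment (P : Pom L) (S : Set P.Occ) : Prop :=
  P.IsLinear S ∧ ∀ c ∉ S, ∀ a ∈ S, ∀ b ∈ S, (P.lt c a ↔ P.lt c b) ∧ (P.lt a c ↔ P.lt b c)

/-- The SP components of a pomset are its maximal linear segments. -/
def IsSPComponent (P : Pom L) (S : Set P.Occ) : Prop := Maximal P.IsLinearSegment S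

end Pom

open Pom

/-! ### Actions -/

/-- The program-order actions: global writes `x := v`, reads `x = v`, and the skip action `δ`. -/
inductive POAct (Loc V : Type*) where
  | write (x : Loc) (v : V)
  | read (x : Loc) (v : V)
  | skip

/-- The TSO actions: program-order actions and buffer writes `x̄ := v`. -/
inductive TSOAct (Loc V : Type*) where
  | po (l : POAct Loc V)
  | bufWrite (x : Loc) (v : V)

namespace TSOAct

variable {Loc V : Type*}

/-- Membership in the set of program-order actions. -/
def isPO : TSOAct Loc V → Bool
  | po _ => true
  | bufWrite _ _ => false

/-- Membership in the set of buffer writes. -/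
def isBuf : TSOAct Loc V → Bool
  | po _ => false
  | bufWrite _ _ => true

/-- Membership in the set of global writes. -/
def isGlob : TSOAct Loc V → Bool
  | po (.write _ _) => true
  | _ => false

/-- The relabelling that turns `x̄ := v` into `x := v` and fixes program-order actions. -/
def toPO : TSOAct Loc V → POAct Loc V
  | po l => l
  | bufWrite x v => .write x v

end TSOAct

/-! ### The programming language and its program orders -/

/-- Value expressions; the operators are arbitrary unary and binary operations on values. -/
inductive VExp (Loc V : Type*) where
  | const (v : V)
  | loc (x : Loc)
  | unop (op : V → V) (e : VExp Loc V)
  | binop (op : V → V → V) (e₁ e₂ : VExp Loc V)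

/-- Boolean expressions; the operators are arbitrary binary relations on values (`=`, `<`, …) and
arbitrary binary operations on truth values (`∨`, `∧`, …). -/
inductive BExp (Loc V : Type*) where
  | const (b : Bool)
  | neg (b : BExp Loc V)
  | cmp (op : V → V → Bool) (e₁ e₂ : VExp Loc V)
  | binop (op : Bool → Bool → Bool) (b₁ b₂ : BExp Loc V)

/-- Commands. A program is a command. -/
inductive Cmd (Loc V : Type*) where
  | skip
  | assign (x : Loc) (e : VExp Loc V)
  | seq (c₁ c₂ : Cmd Loc V)
  | par (c₁ c₂ : Cmd Loc V)
  | ite (b : BExp Loc V) (c₁ c₂ : Cmd Loc V)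
  | while (b : BExp Loc V) (c : Cmd Loc V)

section Denotation

variable {Loc V : Type*}

/-- Program orders of a value expression, with the resulting values. -/
def VExp.po : VExp Loc V → Set (Pom (POAct Loc V) × V)
  | .const v => {(Pom.single .skip, v)}
  | .loc x => {q | ∃ v, q = (Pom.single (.read x v), v)}
  | .unop op e => {q | ∃ P v, (P, v) ∈ e.po ∧ q = (P, op v)}
  | .binop op e₁ e₂ => {q | ∃ P₁ v₁ P₂ v₂, (P₁, v₁) ∈ e₁.po ∧ (P₂, v₂) ∈ e₂.po ∧
      q = (Pom.par P₁ P₂, op v₁ v₂)}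

/-- Program orders of a boolean expression, with the resulting truth values. -/
def BExp.po : BExp Loc V → Set (Pom (POAct Loc V) × Bool)
  | .const b => {(Pom.single .skip, b)}
  | .neg b => {q | ∃ P t, (P, t) ∈ b.po ∧ q = (P, !t)}
  | .cmp op e₁ e₂ => {q | ∃ P₁ v₁ P₂ v₂, (P₁, v₁) ∈ e₁.po ∧ (P₂, v₂) ∈ e₂.po ∧
      q = (Pom.par P₁ P₂, op v₁ v₂)}
  | .binop op b₁ b₂ => {q | ∃ P₁ t₁ P₂ t₂, (P₁, t₁) ∈ b₁.po ∧ (P₂, t₂) ∈ b₂.po ∧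
      q = (Pom.par P₁ P₂, op t₁ t₂)}

/-- The pomsets of `b` that yield the truth value `t`. -/
def BExp.poVal (b : BExp Loc V) (t : Bool) : Set (Pom (POAct Loc V)) := {P | (P, t) ∈ b.po}

/-- Sequential composition, lifted to sets of pomsets. -/
def seqSet {L : Type*} (S T : Set (Pom L)) : Set (Pom L) :=
  {R | ∃ P ∈ S, ∃ Q ∈ T, R = Pom.seq P Q}

/-- Parallel composition, lifted to sets of pomsets. -/
def parSet {L : Type*} (S T : Set (Pom L)) : Set (Pom L) :=
  {R | ∃ P ∈ S, ∃ Q ∈ T, R = Pom.par P Q}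

/-- The `n`-fold unrolling of a loop, from the pomsets `T` and `F` of the guard being true and false
and the pomsets `C` of the body. -/
def loopIter {L : Type*} (T F C : Set (Pom L)) : ℕ → Set (Pom L)
  | 0 => F
  | n + 1 => seqSet T (seqSet C (loopIter T F C n))

/-- The infinite unrollings of a loop. -/
def loopOmega {L : Type*} (T C : Set (Pom L)) : Set (Pom L) :=
  {R | ∃ B D : ℕ → Pom L, (∀ n, B n ∈ T) ∧ (∀ n, D n ∈ C) ∧ R = seqOmega fun n => Pom.seq (B n) (D n)}

/-- The concrete program orders that the semantic clauses assign to a command. -/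
def Cmd.po : Cmd Loc V → Set (Pom (POAct Loc V))
  | .skip => {Pom.single .skip}
  | .assign x e => {R | ∃ P v, (P, v) ∈ e.po ∧ R = Pom.seq P (Pom.single (.write x v))}
  | .seq c₁ c₂ => seqSet c₁.po c₂.po
  | .par c₁ c₂ => parSet c₁.po c₂.po
  | .ite b c₁ c₂ => seqSet (b.poVal true) c₁.po ∪ seqSet (b.poVal false) c₂.po
  | .while b c => (⋃ n, loopIter (b.poVal true) (b.poVal false) c.po n) ∪
      loopOmega (b.poVal true) c.po

/-- The identification of program orders up to skip actions: the same non-empty pomset (up to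
isomorphism) results from deleting finitely many `δ` from `P` and finitely many `δ` from `Q`. -/
def SkipEquiv (P Q : Pom (POAct Loc V)) : Prop :=
  ∃ (A : Set P.Occ) (B : Set Q.Occ), A.Nonempty ∧
    Aᶜ.Finite ∧ (∀ a ∈ Aᶜ, P.label a = .skip) ∧
    Bᶜ.Finite ∧ (∀ b ∈ Bᶜ, Q.label b = .skip) ∧
    Nonempty (Iso (P.restrict A) (Q.restrict B))

/-- The set of program-order pomsets of a program, containing every representative under
isomorphism and under the identification up to skip actions. -/
def PPO (p : Cmd Loc V) : Set (Pom (POAct Loc V)) := {P | ∃ Q ∈ p.po, SkipEquiv P Q}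

end Denotation

/-! ### States -/

/-- Finite partial functions. -/
@[ext] structure FinPart (α β : Type*) where
  toFun : α → Option β
  finite_dom : {a | toFun a ≠ none}.Finite

namespace FinPart

variable {α β : Type*}

/-- The domain of a finite partial function. -/
def dom (f : FinPart α β) : Set α := {a | f.toFun a ≠ none}

/-- The nowhere defined function. -/
def empty : FinPart α β := ⟨fun _ => none, by simp⟩

open Classical in
/-- The function with graph `{(a, b)}`. -/
noncomputable def single (a : α) (b : β) : FinPart α β :=
  ⟨fun a' => if a' = a then some b else none, (Set.finite_singleton a).subset (by
    intro a' h; by_contra h'; simp_all)⟩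

/-- The union of graphs. It is used for consistent arguments only; otherwise `f` prevails. -/
def union (f g : FinPart α β) : FinPart α β :=
  ⟨fun a => (f.toFun a).or (g.toFun a), (f.finite_dom.union g.finite_dom).subset (by
    intro a h; by_contra h'; simp_all)⟩

open Classical in
/-- `f ∖ dom g`: the restriction of `f` to the complement of the domain of `g`. -/
noncomputable def diff {γ : Type*} (f : FinPart α β) (g : FinPart α γ) : FinPart α β :=
  ⟨fun a => if a ∈ g.dom then none else f.toFun a, f.finite_dom.subset (by
    intro a h; by_contra h'; simp_all)⟩

/-- `[f | g] = (f ∖ dom g) ∪ g`: the update of `f` by `g`. -/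
noncomputable def update (f g : FinPart α β) : FinPart α β := (f.diff g).union g

/-- `f` and `g` agree on the intersection of their domains. -/
def Consistent (f g : FinPart α β) : Prop := ∀ a ∈ f.dom ∩ g.dom, f.toFun a = g.toFun a

end FinPart

/-! ### Axiomatic TSO -/

section Axioms

variable {Loc V : Type*}

/-- `l` is a global write action. -/
def POAct.IsWrite (l : POAct Loc V) : Prop := ∃ x v, l = .write x v

/-- `l` is a global write to `x`. -/
def POAct.IsWriteTo (l : POAct Loc V) (x : Loc) : Prop := ∃ v, l = .write x v

/-- `l` is a read action. -/
def POAct.IsRead (l : POAct Loc V) : Prop := ∃ x v, l = .read x v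

/-- The lower closure of `s` under the strict order `lt`. -/
def lowerClosure {α : Type*} (lt : α → α → Prop) (s : α) : Set α := {s' | lt s' s} ∪ {s}

/-- `w` is maximal in `S` under the strict order `lt`. -/
def IsMaxIn {α : Type*} (lt : α → α → Prop) (S : Set α) (w : α) : Prop :=
  w ∈ S ∧ ∀ w' ∈ S, ¬ lt w w'

/-- The writes to `x` in the lower closure of `r` under `lt`. -/
def writesBelow (P : Pom (POAct Loc V)) (lt : P.Occ → P.Occ → Prop) (x : Loc) (r : P.Occ) :
    Set P.Occ :=
  {w | (P.label w).IsWriteTo x} ∩ lowerClosure lt r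

/-- The strict partial order `T` on the occurrences of `P` is TSO-consistent with `P` from the
initial state `σ`. -/
structure TSOConsistentFrom (σ : FinPart Loc V) (P : Pom (POAct Loc V))
    (T : P.Occ → P.Occ → Prop) : Prop where
  strict : IsStrictOrder P.Occ T
  /-- O -/
  ordering : ∀ w w', (P.label w).IsWrite → (P.label w').IsWrite → w ≠ w' → T w w' ∨ T w' w
  /-- V -/
  value : ∀ r x v, P.label r = .read x v →
    (∃ w v', P.label w = .write x v' ∧ IsMaxIn T (writesBelow P T x r) w ∧
      writesBelow P P.lt x r ⊆ lowerClosure T w ∧ v = v') ∨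
    (∃ w v', P.label w = .write x v' ∧ IsMaxIn P.lt (writesBelow P P.lt x r) w ∧
      T r w ∧ v = v') ∨
    (writesBelow P T x r = ∅ ∧ writesBelow P P.lt x r = ∅ ∧ σ.toFun x = some v)
  /-- L -/
  loadOp : ∀ r a, (P.label r).IsRead → P.lt r a → T r a
  /-- S -/
  storeStore : ∀ w w', (P.label w).IsWrite → (P.label w').IsWrite → P.lt w w' → T w w'
  /-- F -/
  fork : ∀ a₁ a₂ a₃, P.lt a₁ a₂ → P.lt a₁ a₃ → P.Incomp a₂ a₃ → T a₁ a₂ ∧ T a₁ a₃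
  /-- J -/
  join : ∀ a₁ a₂ a₃, P.lt a₁ a₃ → P.lt a₂ a₃ → P.Incomp a₁ a₂ → T a₁ a₃ ∧ T a₂ a₃

/-- `T` is TSO-consistent with `P` (from some initial state). -/
def TSOConsistent (P : Pom (POAct Loc V)) (T : P.Occ → P.Occ → Prop) : Prop :=
  ∃ σ, TSOConsistentFrom σ P T

/-- A function that assigns sets of lists (total orders on the occurrences of `P`) to pomsets `P` is
sound if, for every program `p` and every finite `P` among its program orders, it yields only
TSO-consistent total orders. -/
def Sound (f : (P : Pom (POAct Loc V)) → Set (List P.Occ)) : Prop :=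
  ∀ (p : Cmd Loc V) (P : Pom (POAct Loc V)), P ∈ PPO p → Finite P.Occ →
    ∀ L ∈ f P, Enumerates L ∧ TSOConsistent P (Precedes L)

end Axioms

/-! ### Footprints -/

/-- `(v, n) ≈ (v', m)` iff `n = m`, and `v = v'` or `n = 0`. -/
def bufSetoid (V : Type*) : Setoid (V × ℕ) where
  r a b := a.2 = b.2 ∧ (a.1 = b.1 ∨ a.2 = 0)
  iseqv := by
    refine ⟨fun a => ⟨rfl, Or.inl rfl⟩, ?_, ?_⟩
    · rintro a b ⟨h, h' | h'⟩
      · exact ⟨h.symm, Or.inl h'.symm⟩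
      · exact ⟨h.symm, Or.inr (h ▸ h')⟩
    · rintro a b c ⟨h₁, h₂⟩ ⟨h₃, h₄⟩
      refine ⟨h₁.trans h₃, ?_⟩
      rcases h₂ with h₂ | h₂
      · rcases h₄ with h₄ | h₄
        · exact Or.inl (h₂.trans h₄)
        · exact Or.inr (h₁.trans h₄)
      · exact Or.inr h₂

/-- Buffer values `(V × ℕ)/≈`. -/
def BufVal (V : Type*) : Type _ := Quotient (bufSetoid V)

/-- `v_n`: the most recent of `n` buffered writes has value `v`. -/
def bufVal {V : Type*} (v : V) (n : ℕ) : BufVal V := Quotient.mk (bufSetoid V) (v, n)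

/-- Buffered states: a finite partial function on buffer locations (indexed by the locations
themselves) and one on locations. -/
@[ext] structure BState (Loc V : Type*) where
  buf : FinPart Loc (BufVal V)
  mem : FinPart Loc V

namespace BState

variable {Loc V : Type*}

/-- The empty state `[]`. -/
def empty : BState Loc V := ⟨.empty, .empty⟩

/-- Union of (consistent) states. -/
def union (σ τ : BState Loc V) : BState Loc V := ⟨σ.buf.union τ.buf, σ.mem.union τ.mem⟩

/-- `σ ∖ dom τ`. -/
noncomputable def diff (σ τ : BState Loc V) : BState Loc V := ⟨σ.buf.diff τ.buf, σ.mem.diff τ.mem⟩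

/-- `[σ | τ]`. -/
noncomputable def update (σ τ : BState Loc V) : BState Loc V :=
  ⟨σ.buf.update τ.buf, σ.mem.update τ.mem⟩

/-- Consistency of states. -/
def Consistent (σ τ : BState Loc V) : Prop := σ.buf.Consistent τ.buf ∧ σ.mem.Consistent τ.mem

/-- `ζ(σ)`: the state has an empty buffer. -/
def EmptyBuf (σ : BState Loc V) : Prop := ∀ x ∈ σ.buf.dom, ∃ v, σ.buf.toFun x = some (bufVal v 0)

end BState

section Footprint

variable {Loc V : Type*}

/-- Sequential composition of sets of footsteps. -/
def seqFoot (S₁ S₂ : Set (BState Loc V × BState Loc V)) : Set (BState Loc V × BState Loc V) :=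
  {s | ∃ σ₁ τ₁ σ₂ τ₂, (σ₁, τ₁) ∈ S₁ ∧ (σ₂, τ₂) ∈ S₂ ∧ (σ₁.update τ₁).Consistent σ₂ ∧
    s = (σ₁.union (σ₂.diff τ₁), τ₁.update τ₂)}

/-- The footprint of a single action. -/
def actFoot : TSOAct Loc V → Set (BState Loc V × BState Loc V)
  | .po (.read x v) =>
      {(⟨.single x (bufVal v 0), .single x v⟩, .empty)} ∪
      {s | ∃ n : ℕ, s = (⟨.single x (bufVal v (n + 1)), .empty⟩, .empty)}
  | .bufWrite x v =>
      {s | ∃ (v' : V) (n : ℕ), s =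
        (⟨.single x (bufVal v' n), .empty⟩, ⟨.single x (bufVal v (n + 1)), .empty⟩)}
  | .po (.write x v) =>
      {s | ∃ (v' v'' : V) (n : ℕ), s =
        (⟨.single x (bufVal v'' (n + 1)), .single x v'⟩, ⟨.single x (bufVal v'' n), .single x v⟩)}
  | .po .skip => {(.empty, .empty)}

/-- The footprint of a list of global writes (location, value) performed by other threads. -/
def envFoot : List (Loc × V) → Set (BState Loc V × BState Loc V)
  | [] => {(.empty, .empty)}
  | (x, v) :: E =>
      seqFoot {s | ∃ v' : V, s = (⟨.empty, .single x v'⟩, ⟨.empty, .single x v⟩)} (envFoot E)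

/-- An environment list: its entries are occurrences of the pomset `P` (`Sum.inl`) or foreign global
writes (`Sum.inr`). -/
abbrev Env (P : Pom (TSOAct Loc V)) : Type _ := List (P.Occ ⊕ (Loc × V))

/-- `Λ` is a global-write environment for the restriction of `P` to `A`: a linearisation of that
pomset interspersed with foreign global writes. -/
def IsEnv (P : Pom (TSOAct Loc V)) (A : Set P.Occ) (Λ : Env P) : Prop :=
  (Λ.filterMap Sum.getLeft?).Nodup ∧
  (∀ a, a ∈ Λ.filterMap Sum.getLeft? ↔ a ∈ A) ∧
  ∀ a ∈ A, ∀ b ∈ A, P.lt a b → Precedes (Λ.filterMap Sum.getLeft?) a b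

open Classical in
/-- How a component with set of occurrences `A` sees an entry of the environment of a parallel
composition: its own occurrences and foreign writes are kept, the global writes of the other
component become foreign writes, and the other actions of the other component are deleted. -/
noncomputable def viewEntry (P : Pom (TSOAct Loc V)) (A : Set P.Occ) :
    P.Occ ⊕ (Loc × V) → Option (P.Occ ⊕ (Loc × V))
  | .inr w => some (.inr w)
  | .inl a => if a ∈ A then some (.inl a) else
      match P.label a with
      | .po (.write x v) => some (.inr (x, v))
      | _ => none

/-- The restriction of the environment `Λ` to the component `A` of a parallel composition. -/
noncomputable def view (P : Pom (TSOAct Loc V)) (A : Set P.Occ) (Λ : Env P) : Env P :=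
  Λ.filterMap (viewEntry P A)

/-- `FootOn P A Λ σ τ`: `(σ, τ)` is in the footprint of the restriction of `P` to `A` under the
global-write environment `Λ`. -/
inductive FootOn (P : Pom (TSOAct Loc V)) :
    Set P.Occ → Env P → BState Loc V → BState Loc V → Prop
  | act (a : P.Occ) (E₁ E₂ : List (Loc × V)) (σ τ : BState Loc V) :
      (σ, τ) ∈ seqFoot (seqFoot (envFoot E₁) (actFoot (P.label a))) (envFoot E₂) →
      FootOn P {a} (E₁.map Sum.inr ++ [Sum.inl a] ++ E₂.map Sum.inr) σ τ
  | seq (A₁ A₂ : Set P.Occ) (Λ₁ Λ₂ : Env P) (σ₁ τ₁ σ₂ τ₂ : BState Loc V) :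
      (∀ a ∈ A₁, ∀ b ∈ A₂, P.lt a b) →
      IsEnv P A₁ Λ₁ → IsEnv P A₂ Λ₂ →
      FootOn P A₁ Λ₁ σ₁ τ₁ → FootOn P A₂ Λ₂ σ₂ τ₂ →
      (σ₁.update τ₁).Consistent σ₂ →
      FootOn P (A₁ ∪ A₂) (Λ₁ ++ Λ₂) (σ₁.union (σ₂.diff τ₁)) (τ₁.update τ₂)
  | par (A₁ A₂ : Set P.Occ) (Λ : Env P) (σ₁ τ₁ σ₂ τ₂ : BState Loc V) :
      (∀ a ∈ A₁, ∀ b ∈ A₂, P.Incomp a b) →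
      IsEnv P (A₁ ∪ A₂) Λ →
      FootOn P A₁ (view P A₁ Λ) σ₁ τ₁ → FootOn P A₂ (view P A₂ Λ) σ₂ τ₂ →
      σ₁.EmptyBuf → τ₁.EmptyBuf → σ₂.EmptyBuf → τ₂.EmptyBuf →
      σ₁.Consistent σ₂ →
      FootOn P (A₁ ∪ A₂) Λ (σ₁.union σ₂) (τ₁.union τ₂)

/-- The footsteps with empty initial and final buffers in the footprint of `P` under a linearisation
`Λ` of `P` (an environment without foreign writes). -/
def zfoot (P : Pom (TSOAct Loc V)) (Λ : List P.Occ) : Set (BState Loc V × BState Loc V) :=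
  {s | FootOn P Set.univ (Λ.map Sum.inl) s.1 s.2 ∧ s.1.EmptyBuf ∧ s.2.EmptyBuf}

end Footprint

/-! ### Well-balanced pomsets, underlying program orders, and the function 𝒯 -/

section Soundness

variable {Loc V : Type*}

/-- The buffer-write occurrences of `P`. -/
abbrev BufOcc (P : Pom (TSOAct Loc V)) : Type := {a : P.Occ // (P.label a).isBuf = true}

/-- The global-write occurrences of `P`. -/
abbrev GlobOcc (P : Pom (TSOAct Loc V)) : Type := {a : P.Occ // (P.label a).isGlob = true}

/-- `ω` maps the buffer writes of each SP component order-isomorphically onto the global writes of the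
same component, preserves location and value, and every buffer write is below its image. -/
structure IsBalancing (P : Pom (TSOAct Loc V)) (ω : BufOcc P ≃ GlobOcc P) : Prop where
  component : ∀ b, ∃ S, P.IsSPComponent S ∧ b.1 ∈ S ∧ (ω b).1 ∈ S
  order : ∀ S, P.IsSPComponent S → ∀ b b', b.1 ∈ S → b'.1 ∈ S →
    (P.lt b.1 b'.1 ↔ P.lt (ω b).1 (ω b').1)
  label : ∀ b, (P.label (ω b).1).toPO = (P.label b.1).toPO
  below : ∀ b, P.lt b.1 (ω b).1

/-- The underlying program order: delete the global writes and relabel `x̄ := v` as `x := v`. -/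
def U (P : Pom (TSOAct Loc V)) : Pom (POAct Loc V) where
  Occ := {a : P.Occ // ¬ (P.label a).isGlob = true}
  lt := fun a b => P.lt a b
  irrefl := fun a => P.irrefl a
  trans := fun a b c => P.trans a b c
  label := fun a => (P.label a).toPO

/-- The occurrence of `P` with which an occurrence of `U P` is identified: reads and skips with
themselves, and the write that stems from the buffer write `b` with the global write `ω b`. -/
def rep (P : Pom (TSOAct Loc V)) (ω : BufOcc P ≃ GlobOcc P) (u : (U P).Occ) : P.Occ :=
  if h : (P.label u.1).isBuf = true then (ω ⟨u.1, h⟩).1 else u.1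

/-- The function `𝒯`. A list `L` of the occurrences of `P` belongs to `𝒯 P` if there are a
well-balanced (that is, series-parallel and with a balancing `ω`) TSO pomset `P'` with `U P' = P` (up
to the isomorphism `φ`) and a linearisation `Λ` of `P'` with a footstep with empty buffers, such that
`L` is the restriction of `Λ` to program-order actions under the identification of the occurrences
of `P` with the program-order occurrences of `P'`. -/
def 𝒯 (P : Pom (POAct Loc V)) : Set (List P.Occ) :=
  {L | ∃ (P' : Pom (TSOAct Loc V)) (ω : BufOcc P' ≃ GlobOcc P') (φ : Iso (U P') P)
      (Λ : List P'.Occ),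
    P'.IsSP ∧ IsBalancing P' ω ∧ Λ ∈ P'.Lin ∧ (zfoot P' Λ).Nonempty ∧
    L.map (fun p => rep P' ω (φ.toEquiv.symm p)) = Λ.filter (fun a => (P'.label a).isPO)}

end Soundness

end TSO

/-! The order on the occurrences of `U P` compares each buffer write `b` through its global write `ω
b`, so the question is when `b < c` in `P` allows `ω b < c`. An SP component is a linear segment, so
an occurrence outside the component of `b` is related alike to `b` and to `ω b`; only a `c` in that
same component can lie below `ω b`. Axioms S, F and J follow: `ω` is monotone
(`IsBalancing.glob_lt_glob`), and at a fork or join the occurrence `c` cannot share the component of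
`b`. O holds because the list is total. L holds because a read represents itself and `rep` only
moves its target upwards.

Axiom V needs the footprint. Memory is easy: every global write is visible to every component, so a
read from memory sees the last write to `x` before it in the list, or the initial state if there is
none. Buffers are handled by counting: along any set of occurrences, initial count plus buffer
writes equals final count plus global writes, and a non-empty final buffer that received a write
shows the value of the last one (`BufRun`, `FootOn.bufStep`).

The read is followed from its leaf up the footprint derivation (`FootOn.read`). Through sequential
nodes it stays comparable to everything, and the buffer it sees is the result of what lies below it;
nothing can be concluded yet, because a sequential cut may split an SP component. At a parallel
node, or at the root, the buffers start empty and the component is closed under SP components, hence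
under `ω`. If the read saw an empty buffer, as many global as buffer writes to `x` precede it, so
each preceding buffer write is already flushed (`IsBalancing.flushed`); this gives V(a) or V(c). If
it saw a non-empty buffer, the last buffer write is not yet flushed, and its global write comes
after the read (`IsBalancing.forwarded`); this gives V(b). -/

namespace TSO

open Pom

/-! ### Pointwise behaviour of partial functions -/

section Pointwise

variable {α β : Type*}

theorem FinPart.union_apply (f g : FinPart α β) (a : α) :
    (f.union g).toFun a = (f.toFun a).or (g.toFun a) := rfl

open Classical in
theorem FinPart.diff_apply {γ : Type*} (f : FinPart α β) (g : FinPart α γ) (a : α) :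
    (f.diff g).toFun a = if g.toFun a = none then f.toFun a else none := by
  simp only [FinPart.diff, FinPart.dom, Set.mem_ofPred_eq]
  split_ifs <;> simp_all

theorem FinPart.update_apply (f g : FinPart α β) (a : α) :
    (f.update g).toFun a = (g.toFun a).or (f.toFun a) := by
  rw [FinPart.update, FinPart.union_apply, FinPart.diff_apply]
  split_ifs with h
  · simp [h]
  · obtain ⟨b, hb⟩ := Option.ne_none_iff_exists'.1 h
    simp [hb]

open Classical in
theorem FinPart.single_apply (a : α) (b : β) (a' : α) :
    (FinPart.single a b).toFun a' = if a' = a then some b else none := rfl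

theorem FinPart.empty_apply (a : α) : (FinPart.empty : FinPart α β).toFun a = none := rfl

theorem FinPart.Consistent.eq {f g : FinPart α β} (h : f.Consistent g) {a : α} {p q : β}
    (hp : f.toFun a = some p) (hq : g.toFun a = some q) : p = q := by
  have := h a ⟨by simp [FinPart.dom, hp], by simp [FinPart.dom, hq]⟩
  simpa [hp, hq] using this

/-- The value `b` satisfies the requirement `s`, if there is one. -/
def Compat (s : Option β) (b : β) : Prop := ∀ p, s = some p → p = b

-- Here `s` is the requirement and `t` the effect of a footstep at one location; `t.getD b` is the
-- value after the step, unchanged where nothing is written. A start value that meets the composite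
-- requirement meets each partial requirement when its step begins.
open Classical in
theorem Compat.of_seq {s₁ t₁ s₂ : Option β} {b : β}
    (hc : ∀ p q, t₁.or s₁ = some p → s₂ = some q → p = q)
    (h : Compat (s₁.or (if t₁ = none then s₂ else none)) b) :
    Compat s₁ b ∧ Compat s₂ (t₁.getD b) := by
  cases s₁ <;> cases t₁ <;> cases s₂ <;> simp_all [Compat]

theorem Compat.of_par {s₁ s₂ : Option β} {b : β}
    (hc : ∀ p q, s₁ = some p → s₂ = some q → p = q) (h : Compat (s₁.or s₂) b) :
    Compat s₁ b ∧ Compat s₂ b := by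
  cases s₁ <;> cases s₂ <;> simp_all [Compat]

theorem or_getD (t₁ t₂ : Option β) (b : β) : (t₂.or t₁).getD b = t₂.getD (t₁.getD b) := by
  cases t₁ <;> cases t₂ <;> rfl

end Pointwise

/-! ### Buffer values -/

section BufVal

variable {V : Type*}

/-- The number of buffered writes. -/
def BufVal.count (β : BufVal V) : ℕ := Quotient.lift (s := bufSetoid V) Prod.snd (fun _ _ h => h.1) β

@[simp] theorem count_bufVal (v : V) (n : ℕ) : (bufVal v n).count = n := rfl

theorem bufVal_eq_iff {v v' : V} {n n' : ℕ} :
    bufVal v n = bufVal v' n' ↔ n = n' ∧ (v = v' ∨ n = 0) :=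
  Quotient.eq (r := bufSetoid V)

end BufVal

/-! ### Effect of a set of occurrences on a buffer -/

section BufRun

variable {Loc V : Type*} (P : Pom (TSOAct Loc V)) (x : Loc)

/-- The occurrence `a` is a buffer write to `x`. -/
def BufTo (a : P.Occ) : Prop := ∃ v, P.label a = .bufWrite x v

/-- The occurrence `a` is a global write to `x`. -/
def GlobTo (a : P.Occ) : Prop := ∃ v, P.label a = .po (.write x v)

/-- The number of buffer writes to `x` in `A`. -/
noncomputable def bufs (A : Set P.Occ) : ℕ := {a ∈ A | BufTo P x a}.ncard

/-- The number of global writes to `x` in `A`. -/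
noncomputable def globs (A : Set P.Occ) : ℕ := {a ∈ A | GlobTo P x a}.ncard

/-- Executing the occurrences in `A` may turn the buffer value `β` of `x` into `β'`: the numbers of
buffered writes match, and a non-empty buffer has the value of the last buffer write in `A`. -/
structure BufRun (A : Set P.Occ) (β β' : BufVal V) : Prop where
  count : β.count + bufs P x A = β'.count + globs P x A
  value : β'.count = 0 ∨
    (bufs P x A = 0 ∧ ∀ v, β = bufVal v β.count → β' = bufVal v β'.count) ∨
    ∃ b ∈ A, ∃ v, P.label b = .bufWrite x v ∧ β' = bufVal v β'.count ∧
      ∀ b' ∈ A, BufTo P x b' → b' = b ∨ P.lt b' b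

variable {P x}

theorem ncard_sep_union [Finite P.Occ] {A B : Set P.Occ} (h : Disjoint A B) (p : P.Occ → Prop) :
    {a ∈ A ∪ B | p a}.ncard = {a ∈ A | p a}.ncard + {a ∈ B | p a}.ncard := by
  rw [← Set.ncard_union_eq _ (Set.toFinite _) (Set.toFinite _)]
  · congr 1
    ext a
    simp [or_and_right]
  · exact h.mono (Set.sep_subset _ _) (Set.sep_subset _ _)

theorem bufs_union [Finite P.Occ] {A B : Set P.Occ} (h : Disjoint A B) :
    bufs P x (A ∪ B) = bufs P x A + bufs P x B := ncard_sep_union h _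

theorem globs_union [Finite P.Occ] {A B : Set P.Occ} (h : Disjoint A B) :
    globs P x (A ∪ B) = globs P x A + globs P x B := ncard_sep_union h _

theorem bufs_eq_zero [Finite P.Occ] {A : Set P.Occ} :
    bufs P x A = 0 ↔ ∀ a ∈ A, ¬ BufTo P x a := by
  rw [bufs, Set.ncard_eq_zero (Set.toFinite _)]
  simp [Set.eq_empty_iff_forall_notMem]

theorem disjoint_of_lt {A B : Set P.Occ} (h : ∀ a ∈ A, ∀ b ∈ B, P.lt a b) : Disjoint A B :=
  Set.disjoint_left.2 fun a ha hb => P.irrefl a (h a ha a hb)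

theorem disjoint_of_incomp {A B : Set P.Occ} (h : ∀ a ∈ A, ∀ b ∈ B, P.Incomp a b) :
    Disjoint A B :=
  Set.disjoint_left.2 fun a ha hb => (h a ha a hb).1 rfl

theorem BufRun.empty (β : BufVal V) : BufRun P x ∅ β β :=
  ⟨by simp [bufs, globs], .inr (.inl ⟨by simp [bufs], fun _ h => h⟩)⟩

theorem BufRun.trans [Finite P.Occ] {A₁ A₂ : Set P.Occ} (hlt : ∀ a ∈ A₁, ∀ b ∈ A₂, P.lt a b)
    {β₀ β₁ β₂ : BufVal V} (h₁ : BufRun P x A₁ β₀ β₁) (h₂ : BufRun P x A₂ β₁ β₂) :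
    BufRun P x (A₁ ∪ A₂) β₀ β₂ := by
  have hd := disjoint_of_lt hlt
  have c₁ := h₁.count
  have c₂ := h₂.count
  refine ⟨by rw [bufs_union hd, globs_union hd]; omega, ?_⟩
  rcases h₂.value with h | ⟨h0, hv⟩ | ⟨b, hb, v, hl, hv, hmax⟩
  · exact .inl h
  · rcases h₁.value with h | ⟨h0', hv'⟩ | ⟨b, hb, v, hl, hv', hmax⟩
    -- A buffer that is empty in between and receives no further writes stays empty, by counting.
    · exact .inl (by omega)
    · exact .inr (.inl ⟨by rw [bufs_union hd]; omega, fun v h => hv v (hv' v h)⟩)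
    · refine .inr (.inr ⟨b, .inl hb, v, hl, hv v hv', ?_⟩)
      rintro b' (hb' | hb') hto
      · exact hmax b' hb' hto
      · exact absurd hto (bufs_eq_zero.1 h0 b' hb')
  · refine .inr (.inr ⟨b, .inr hb, v, hl, hv, ?_⟩)
    rintro b' (hb' | hb') hto
    · exact .inr (hlt _ hb' _ hb)
    · exact hmax b' hb' hto

end BufRun

/-! ### Order-theoretic consequences of balancing -/

section Balancing

variable {Loc V : Type*} {P : Pom (TSOAct Loc V)} {ω : BufOcc P ≃ GlobOcc P}

/-- Every occurrence outside `A` is related in the same way to all elements of `A`. -/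
def IsModule {L : Type*} (P : Pom L) (A : Set P.Occ) : Prop :=
  ∀ c ∉ A, ∀ a ∈ A, ∀ b ∈ A, (P.lt c a ↔ P.lt c b) ∧ (P.lt a c ↔ P.lt b c)

/-- Every SP component that meets `A` is contained in `A`. -/
def ComponentClosed {L : Type*} (P : Pom L) (A : Set P.Occ) : Prop :=
  ∀ S, P.IsSPComponent S → ∀ a ∈ S, a ∈ A → S ⊆ A

/-- The segment property makes an outside occurrence unable to distinguish `b` from `ω b`, so
reordering is confined to one SP component. -/
theorem IsBalancing.glob_lt_or_mem_component (h : IsBalancing P ω) {b : BufOcc P} {c : P.Occ}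
    (hlt : P.lt b.1 c) : P.lt (ω b).1 c ∨
      ∃ S, P.IsSPComponent S ∧ b.1 ∈ S ∧ (ω b).1 ∈ S ∧ c ∈ S := by
  obtain ⟨S, hS, hb, hg⟩ := h.component b
  by_cases hc : c ∈ S
  · exact .inr ⟨S, hS, hb, hg, hc⟩
  · exact .inl (((hS.prop.2 c hc b.1 hb _ hg).2).1 hlt)

theorem IsBalancing.glob_lt_glob (h : IsBalancing P ω) {b b' : BufOcc P} (hlt : P.lt b.1 b'.1) :
    P.lt (ω b).1 (ω b').1 := by
  rcases h.glob_lt_or_mem_component hlt with h' | ⟨S, hS, hb, -, hb'⟩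
  · exact P.trans _ _ _ h' (h.below b')
  · exact (h.order S hS b b' hb hb').1 hlt

/-- If `c` were in the component of `b`, then `d` could not be, since a component is a chain; but
then `d` is above all of the component, in particular above `c`. -/
theorem IsBalancing.glob_lt_of_fork (h : IsBalancing P ω) {b : BufOcc P} {c d : P.Occ}
    (hc : P.lt b.1 c) (hd : P.lt b.1 d) (hi : P.Incomp c d) : P.lt (ω b).1 c := by
  rcases h.glob_lt_or_mem_component hc with h' | ⟨S, hS, hb, -, hcS⟩
  · exact h'
  · exfalso
    by_cases hdS : d ∈ S
    · exact (hS.prop.1 c hcS d hdS hi.1).elim hi.2.1 hi.2.2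
    · exact hi.2.1 (((hS.prop.2 d hdS _ hb _ hcS).2).1 hd)

theorem IsBalancing.glob_lt_of_join (h : IsBalancing P ω) {b : BufOcc P} {c d : P.Occ}
    (hb : P.lt b.1 c) (hd : P.lt d c) (hi : P.Incomp b.1 d) : P.lt (ω b).1 c := by
  rcases h.glob_lt_or_mem_component hb with h' | ⟨S, hS, hbS, -, hcS⟩
  · exact h'
  · exfalso
    by_cases hdS : d ∈ S
    · exact (hS.prop.1 _ hbS d hdS hi.1).elim hi.2.1 hi.2.2
    · exact hi.2.2 (((hS.prop.2 d hdS _ hbS _ hcS).1).2 hd)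

theorem IsBalancing.label_glob (h : IsBalancing P ω) {b : BufOcc P} {x : Loc} {v : V}
    (hb : P.label b.1 = .bufWrite x v) : P.label (ω b).1 = .po (.write x v) := by
  have h₁ := h.label b
  have h₂ := (ω b).2
  rw [hb] at h₁
  cases hl : P.label (ω b).1 with
  | po l => rw [hl] at h₁; simpa [TSOAct.toPO] using h₁
  | bufWrite y u => rw [hl] at h₂; simp [TSOAct.isGlob] at h₂

theorem IsBalancing.label_buf (h : IsBalancing P ω) {b : BufOcc P} {x : Loc} {v : V}
    (hg : P.label (ω b).1 = .po (.write x v)) : P.label b.1 = .bufWrite x v := by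
  have h₁ := h.label b
  have h₂ := b.2
  rw [hg] at h₁
  cases hl : P.label b.1 with
  | bufWrite y u => rw [hl] at h₁; simp [TSOAct.toPO] at h₁; simp [h₁]
  | po l => rw [hl] at h₂; simp [TSOAct.isBuf] at h₂

theorem BufTo.isBuf {x : Loc} {a : P.Occ} (h : BufTo P x a) : (P.label a).isBuf = true := by
  obtain ⟨v, hv⟩ := h
  rw [hv]; rfl

theorem GlobTo.isGlob {x : Loc} {a : P.Occ} (h : GlobTo P x a) : (P.label a).isGlob = true := by
  obtain ⟨v, hv⟩ := h
  rw [hv]; rfl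

/-- Modularity is taken relative to the whole pomset, so that it can be passed down the footprint
derivation. -/
theorem IsModule.left_of_lt {A B : Set P.Occ} (h : IsModule P (A ∪ B))
    (hlt : ∀ a ∈ A, ∀ b ∈ B, P.lt a b) : IsModule P A := by
  intro c hc a ha a' ha'
  by_cases hcB : c ∈ B
  · have h₁ := hlt a ha c hcB
    have h₂ := hlt a' ha' c hcB
    exact ⟨⟨fun h => (P.irrefl _ (P.trans _ _ _ h h₁)).elim,
      fun h => (P.irrefl _ (P.trans _ _ _ h h₂)).elim⟩, by simp [h₁, h₂]⟩
  · exact h c (by simp [hc, hcB]) a (.inl ha) a' (.inl ha')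

theorem IsModule.right_of_lt {A B : Set P.Occ} (h : IsModule P (A ∪ B))
    (hlt : ∀ a ∈ A, ∀ b ∈ B, P.lt a b) : IsModule P B := by
  intro c hc a ha a' ha'
  by_cases hcA : c ∈ A
  · have h₁ := hlt c hcA a ha
    have h₂ := hlt c hcA a' ha'
    exact ⟨by simp [h₁, h₂], ⟨fun h => (P.irrefl _ (P.trans _ _ _ h h₁)).elim,
      fun h => (P.irrefl _ (P.trans _ _ _ h h₂)).elim⟩⟩
  · exact h c (by simp [hc, hcA]) a (.inr ha) a' (.inr ha')

theorem incomp_symm {a b : P.Occ} (h : P.Incomp a b) : P.Incomp b a :=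
  ⟨h.1.symm, h.2.2, h.2.1⟩

theorem IsModule.left_of_incomp {A B : Set P.Occ} (h : IsModule P (A ∪ B))
    (hi : ∀ a ∈ A, ∀ b ∈ B, P.Incomp a b) : IsModule P A := by
  intro c hc a ha a' ha'
  by_cases hcB : c ∈ B
  · have h₁ := hi a ha c hcB
    have h₂ := hi a' ha' c hcB
    simp [h₁.2.1, h₁.2.2, h₂.2.1, h₂.2.2]
  · exact h c (by simp [hc, hcB]) a (.inl ha) a' (.inl ha')

/-- Suppose a chain leaves `A` through `c`. Then `c` is not in `B`, and modularity of `A ∪ B` makes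
`c` comparable to `d ∈ B` because it is comparable to `a`. As `d` lies outside the segment, it must
then be comparable to `a` as well. A non-empty `B` is essential. -/
theorem ComponentClosed.of_incomp {A B : Set P.Occ} (h : IsModule P (A ∪ B)) (hB : B.Nonempty)
    (hi : ∀ a ∈ A, ∀ b ∈ B, P.Incomp a b) : ComponentClosed P A := by
  intro S hS a haS haA c hcS
  by_contra hcA
  have hca : a ≠ c := fun h => hcA (h ▸ haA)
  have hcomp := hS.prop.1 a haS c hcS hca
  by_cases hcB : c ∈ B
  · have := hi a haA c hcB
    exact hcomp.elim this.2.1 this.2.2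
  · obtain ⟨d, hd⟩ := hB
    have hadi := hi a haA d hd
    have hdS : d ∉ S := fun h => (hS.prop.1 a haS d h hadi.1).elim hadi.2.1 hadi.2.2
    have h₁ := h c (by simp [hcA, hcB]) a (.inl haA) d (.inr hd)
    have h₂ := hS.prop.2 d hdS a haS c hcS
    rcases hcomp with h' | h'
    · exact hadi.2.2 (h₂.1.2 (h₁.2.1 h'))
    · exact hadi.2.1 (h₂.2.2 (h₁.1.1 h'))

/-- Every buffer write to `x` below `r` is matched by a global write below `r`. -/
def Flushed (P : Pom (TSOAct Loc V)) (ω : BufOcc P ≃ GlobOcc P) (x : Loc) (r : P.Occ) : Prop :=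
  ∀ b : BufOcc P, BufTo P x b.1 → P.lt b.1 r → P.lt (ω b).1 r

/-- A buffer write of `v` to `x` is maximal among the buffer writes to `x` below `r`, and the
matching global write is above `r`. -/
def Forwarded (P : Pom (TSOAct Loc V)) (ω : BufOcc P ≃ GlobOcc P) (x : Loc) (v : V) (r : P.Occ) :
    Prop :=
  ∃ b : BufOcc P, P.label b.1 = .bufWrite x v ∧ P.lt b.1 r ∧ P.lt r (ω b).1 ∧
    ∀ b', BufTo P x b' → P.lt b' r → ¬ P.lt b.1 b'

/-- The image of a buffer write under the balancing; other occurrences are fixed. -/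
def globOf (ω : BufOcc P ≃ GlobOcc P) (a : P.Occ) : P.Occ :=
  if h : (P.label a).isBuf = true then (ω ⟨a, h⟩).1 else a

theorem globOf_buf (ω : BufOcc P ≃ GlobOcc P) (b : BufOcc P) : globOf ω b.1 = (ω b).1 := by
  simp [globOf, b.2]

theorem IsBalancing.mem_iff (h : IsBalancing P ω) {A : Set P.Occ} (hA : ComponentClosed P A)
    (b : BufOcc P) : b.1 ∈ A ↔ (ω b).1 ∈ A := by
  obtain ⟨S, hS, hb, hg⟩ := h.component b
  exact ⟨fun h => hA S hS _ hb h hg, fun h => hA S hS _ hg h hb⟩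

/-- Global writes below `r` come from buffer writes below `r`, so they lie in the `ω`-image of the
latter. Equal numbers turn this inclusion into equality. -/
theorem IsBalancing.flushed [Finite P.Occ] (h : IsBalancing P ω) {A : Set P.Occ}
    (hA : ComponentClosed P A) {x : Loc} {r : P.Occ} (hr : r ∈ A)
    (hcount : bufs P x {a ∈ A | P.lt a r} = globs P x {a ∈ A | P.lt a r}) : Flushed P ω x r := by
  intro b hbx hbr
  rcases h.glob_lt_or_mem_component hbr with h' | ⟨S, hS, hbS, -, hrS⟩
  · exact h'
  have hbA : b.1 ∈ A := hA S hS r hrS hr hbS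
  set D := {a ∈ A | P.lt a r} with hD
  have hsub : {a ∈ D | GlobTo P x a} ⊆ globOf ω '' {a ∈ D | BufTo P x a} := by
    rintro g ⟨⟨hgA, hgr⟩, hgx⟩
    obtain ⟨b', hb'⟩ : ∃ b', ω b' = ⟨g, hgx.isGlob⟩ := ω.surjective _
    have hg : (ω b').1 = g := by rw [hb']
    refine ⟨b'.1, ⟨⟨(h.mem_iff hA b').2 (hg ▸ hgA), P.trans _ _ _ (h.below b') (hg ▸ hgr)⟩, ?_⟩,
      by rw [globOf_buf, hg]⟩
    obtain ⟨v, hv⟩ := hgx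
    exact ⟨v, h.label_buf (by rw [hg, hv])⟩
  have heq := Set.eq_of_subset_of_ncard_le hsub
    ((Set.ncard_image_le (Set.toFinite _)).trans hcount.le) (Set.toFinite _)
  have : globOf ω b.1 ∈ {a ∈ D | GlobTo P x a} := by
    rw [heq]
    exact ⟨b.1, ⟨⟨hbA, hbr⟩, hbx⟩, rfl⟩
  rw [globOf_buf] at this
  exact this.1.2

/-- If the last buffer write were flushed before `r`, then by monotonicity of `ω` so would all
earlier ones, and the global writes below `r` would be at least as many as the buffer writes. -/
theorem IsBalancing.forwarded [Finite P.Occ] (h : IsBalancing P ω) {A : Set P.Occ}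
    (hA : ComponentClosed P A) (hmod : IsModule P A) {x : Loc} {v : V} {r : P.Occ} (hr : r ∈ A)
    (hread : (P.label r).isGlob = false) (htot : ∀ a ∈ A, a ≠ r → P.lt a r ∨ P.lt r a)
    (hcount : globs P x {a ∈ A | P.lt a r} < bufs P x {a ∈ A | P.lt a r})
    {b : P.Occ} (hbA : b ∈ A) (hbr : P.lt b r) (hbx : P.label b = .bufWrite x v)
    (hmax : ∀ b' ∈ A, P.lt b' r → BufTo P x b' → b' = b ∨ P.lt b' b) : Forwarded P ω x v r := by
  have hbuf : (P.label b).isBuf = true := by rw [hbx]; rfl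
  refine ⟨⟨b, hbuf⟩, hbx, hbr, ?_, ?_⟩
  · have hne : (ω ⟨b, hbuf⟩).1 ≠ r := fun he => by
      have := (ω ⟨b, hbuf⟩).2
      rw [he, hread] at this
      cases this
    refine (htot _ ((h.mem_iff hA ⟨b, hbuf⟩).1 hbA) hne).resolve_left fun hlt => ?_
    refine hcount.not_ge (Set.ncard_le_ncard_of_injOn (globOf ω) ?_ ?_ (Set.toFinite _))
    · rintro b' ⟨⟨hb'A, hb'r⟩, hb'x⟩
      obtain ⟨u, hu⟩ := id hb'x
      have hg : globOf ω b' = (ω ⟨b', hb'x.isBuf⟩).1 := globOf_buf ω ⟨b', hb'x.isBuf⟩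
      have hlab := h.label_glob (b := ⟨b', hb'x.isBuf⟩) hu
      refine ⟨⟨?_, ?_⟩, u, by rw [hg, hlab]⟩
      · rw [hg]; exact (h.mem_iff hA ⟨b', hb'x.isBuf⟩).1 hb'A
      · rcases hmax b' hb'A hb'r hb'x with rfl | hb'b
        · rw [hg]; exact hlt
        · rw [hg]
          exact P.trans _ _ _ (h.glob_lt_glob (b := ⟨b', hb'x.isBuf⟩) (b' := ⟨b, hbuf⟩) hb'b) hlt
    · rintro a ⟨-, ha⟩ a' ⟨-, ha'⟩ he
      have h₁ := globOf_buf ω ⟨a, ha.isBuf⟩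
      have h₂ := globOf_buf ω ⟨a', ha'.isBuf⟩
      simp only at h₁ h₂
      rw [h₁, h₂] at he
      simpa using ω.injective (Subtype.ext he)
  · intro b' hb'x hb'r hlt
    simp only at hlt
    by_cases hb'A : b' ∈ A
    · rcases hmax b' hb'A hb'r hb'x with rfl | h'
      · exact P.irrefl _ hlt
      · exact P.irrefl _ (P.trans _ _ _ hlt h')
    -- Outside the module `A`, an occurrence above `b` is also above `r`, so it cannot be below `r`.
    · exact P.irrefl _ (P.trans _ _ _ (((hmod b' hb'A b hbA r hr).2).1 hlt) hb'r)

end Balancing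

/-! ### Write histories -/

section Writes

variable {Loc V : Type*}

open Classical in
/-- The value of the last write to `x` in a list of writes. -/
noncomputable def lastVal (x : Loc) : List (Loc × V) → Option V
  | [] => none
  | (y, v) :: E => (lastVal x E).or (if x = y then some v else none)

theorem lastVal_append (x : Loc) (E₁ E₂ : List (Loc × V)) :
    lastVal x (E₁ ++ E₂) = (lastVal x E₂).or (lastVal x E₁) := by
  induction E₁ with
  | nil => simp [lastVal]
  | cons w E₁ ih => simp [lastVal, ih, Option.or_assoc]

theorem lastVal_eq_none {x : Loc} {E : List (Loc × V)} (h : lastVal x E = none) (v : V) :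
    (x, v) ∉ E := by
  induction E with
  | nil => simp
  | cons w E ih =>
    obtain ⟨y, u⟩ := w
    simp only [lastVal, Option.or_eq_none_iff] at h
    simp only [List.mem_cons, Prod.mk.injEq, not_or, not_and]
    exact ⟨fun hx => by simp [hx] at h, ih h.1⟩

theorem lastVal_eq_some {x : Loc} {v : V} {E : List (Loc × V)} (h : lastVal x E = some v) :
    ∃ E₁ E₂, E = E₁ ++ (x, v) :: E₂ ∧ lastVal x E₂ = none := by
  induction E with
  | nil => simp [lastVal] at h
  | cons w E ih =>
    obtain ⟨y, u⟩ := w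
    simp only [lastVal] at h
    cases hE : lastVal x E with
    | none =>
      simp only [hE, Option.none_or, Option.ite_none_right_eq_some, Option.some.injEq] at h
      obtain ⟨rfl, rfl⟩ := h
      exact ⟨[], E, rfl, hE⟩
    | some v' =>
      rw [hE] at h
      obtain ⟨E₁, E₂, rfl, h₂⟩ := ih (hE.trans (by simpa using h))
      exact ⟨(y, u) :: E₁, E₂, rfl, h₂⟩

/-- The global write that an entry of an environment performs, if any. -/
def writeEntry (P : Pom (TSOAct Loc V)) : P.Occ ⊕ (Loc × V) → Option (Loc × V)
  | .inr w => some w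
  | .inl a => match P.label a with
    | .po (.write x v) => some (x, v)
    | _ => none

/-- The global writes of an environment. -/
def writes (P : Pom (TSOAct Loc V)) (Λ : Env P) : List (Loc × V) := Λ.filterMap (writeEntry P)

theorem writes_append (P : Pom (TSOAct Loc V)) (Λ₁ Λ₂ : Env P) :
    writes P (Λ₁ ++ Λ₂) = writes P Λ₁ ++ writes P Λ₂ := List.filterMap_append

theorem writes_map_inr (P : Pom (TSOAct Loc V)) (E : List (Loc × V)) :
    writes P (E.map Sum.inr) = E := by
  simp only [writes, List.filterMap_map]
  exact List.filterMap_some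

/-- Restriction to a component turns the other side's global writes into foreign ones but drops
none: memory is shared. -/
theorem writes_view (P : Pom (TSOAct Loc V)) (A : Set P.Occ) (Λ : Env P) :
    writes P (view P A Λ) = writes P Λ := by
  simp only [writes, view, List.filterMap_filterMap]
  congr 1
  funext e
  rcases e with a | w
  · simp only [viewEntry]
    split_ifs
    · rfl
    · simp only [writeEntry]
      cases P.label a with
      | bufWrite y v => rfl
      | po l => cases l <;> rfl
  · rfl

end Writes

/-! ### Footprints pointwise -/

section Pointwise

variable {Loc V : Type*}

theorem envFoot_buf {E : List (Loc × V)} {σ τ : BState Loc V} (h : (σ, τ) ∈ envFoot E) (x : Loc) :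
    σ.buf.toFun x = none ∧ τ.buf.toFun x = none := by
  induction E generalizing σ τ with
  | nil => cases h; exact ⟨rfl, rfl⟩
  | cons w E ih =>
    obtain ⟨σ₁, τ₁, σ₂, τ₂, ⟨v', h₁⟩, h₂, -, heq⟩ := h
    cases heq
    cases h₁
    have := ih h₂
    simp [BState.union, BState.diff, BState.update, FinPart.union_apply, FinPart.diff_apply,
      FinPart.update_apply, FinPart.empty_apply, this]

theorem envFoot_mem {E : List (Loc × V)} {σ τ : BState Loc V} (h : (σ, τ) ∈ envFoot E) (x : Loc) :
    τ.mem.toFun x = lastVal x E := by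
  induction E generalizing σ τ with
  | nil => cases h; rfl
  | cons w E ih =>
    obtain ⟨σ₁, τ₁, σ₂, τ₂, ⟨v', h₁⟩, h₂, -, heq⟩ := h
    cases heq
    cases h₁
    simp only [BState.update, FinPart.update_apply, ih h₂, lastVal, FinPart.single_apply]

/-- Foreign writes touch only memory, so the buffer part is that of the action; its memory
requirement is met by the last foreign write before it or else by the initial state. -/
theorem actFoot_env {l : TSOAct Loc V} {E₁ E₂ : List (Loc × V)} {σ τ : BState Loc V}
    (h : (σ, τ) ∈ seqFoot (seqFoot (envFoot E₁) (actFoot l)) (envFoot E₂)) :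
    ∃ σ₀ τ₀, (σ₀, τ₀) ∈ actFoot l ∧ ∀ x,
      σ.buf.toFun x = σ₀.buf.toFun x ∧ τ.buf.toFun x = τ₀.buf.toFun x ∧
      τ.mem.toFun x = (lastVal x E₂).or ((τ₀.mem.toFun x).or (lastVal x E₁)) ∧
      ∀ v, σ₀.mem.toFun x = some v → (lastVal x E₁).or (σ.mem.toFun x) = some v := by
  obtain ⟨σ₁₂, τ₁₂, σ₃, τ₃, ⟨σ₁, τ₁, σ₂, τ₂, h₁, h₂, hc₁, heq₁⟩, h₃, -, heq₂⟩ := h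
  cases heq₁
  cases heq₂
  refine ⟨σ₂, τ₂, h₂, fun x => ?_⟩
  have b₁ := envFoot_buf h₁ x
  have b₃ := envFoot_buf h₃ x
  have m₁ := envFoot_mem h₁ x
  have m₃ := envFoot_mem h₃ x
  refine ⟨?_, ?_, ?_, ?_⟩
  · simp [BState.union, BState.diff, FinPart.union_apply, FinPart.diff_apply, b₁, b₃]
  · simp [BState.update, FinPart.update_apply, b₁, b₃]
  · simp [BState.update, FinPart.update_apply, m₁, m₃]
  · intro v hv
    simp only [BState.union, BState.diff, FinPart.union_apply, FinPart.diff_apply]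
    rw [← m₁]
    have hc : ∀ p, (τ₁.mem.toFun x).or (σ₁.mem.toFun x) = some p → p = v := fun p hp =>
      hc₁.2.eq (by rw [BState.update, FinPart.update_apply, hp]) hv
    clear m₁ m₃
    cases ht : τ₁.mem.toFun x <;> cases hs : σ₁.mem.toFun x <;> simp_all

end Pointwise

/-! ### Invariants of footprints -/

section Invariants

variable {Loc V : Type*} {P : Pom (TSOAct Loc V)}

theorem FootOn.nonempty {A : Set P.Occ} {Λ : Env P} {σ τ : BState Loc V} (h : FootOn P A Λ σ τ) :
    A.Nonempty := by
  induction h with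
  | act a => exact ⟨a, rfl⟩
  | seq _ _ _ _ _ _ _ _ _ _ _ _ _ _ ih => exact ih.inl
  | par _ _ _ _ _ _ _ _ _ _ _ _ _ _ _ _ ih => exact ih.inl

/-- Both sides of a parallel composition see the same global writes, so their final memories
coincide. -/
theorem FootOn.mem_eq_lastVal {A : Set P.Occ} {Λ : Env P} {σ τ : BState Loc V}
    (h : FootOn P A Λ σ τ) (x : Loc) : τ.mem.toFun x = lastVal x (writes P Λ) := by
  induction h with
  | act a E₁ E₂ σ τ h =>
    obtain ⟨σ₀, τ₀, h₀, hx⟩ := actFoot_env h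
    rw [(hx x).2.2.1, writes_append, writes_append, writes_map_inr, writes_map_inr, lastVal_append,
      lastVal_append]
    congr 2
    rcases hl : P.label a with (⟨y, v⟩ | ⟨y, v⟩ | _) | ⟨y, v⟩ <;> rw [hl] at h₀
    · obtain ⟨v', v'', n, h₀⟩ := h₀
      cases h₀
      simp [writes, writeEntry, hl, lastVal, FinPart.single_apply]
    · rcases h₀ with h₀ | ⟨n, h₀⟩ <;> cases h₀ <;>
        simp [writes, writeEntry, hl, lastVal, BState.empty, FinPart.empty_apply]
    · cases h₀
      simp [writes, writeEntry, hl, lastVal, BState.empty, FinPart.empty_apply]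
    · obtain ⟨v', n, h₀⟩ := h₀
      cases h₀
      simp [writes, writeEntry, hl, lastVal, FinPart.empty_apply]
  | seq A₁ A₂ Λ₁ Λ₂ σ₁ τ₁ σ₂ τ₂ _ _ _ _ _ _ ih₁ ih₂ =>
    rw [writes_append, lastVal_append, BState.update, FinPart.update_apply, ih₁, ih₂]
  | par A₁ A₂ Λ σ₁ τ₁ σ₂ τ₂ _ _ _ _ _ _ _ _ _ ih₁ ih₂ =>
    rw [BState.union, FinPart.union_apply, ih₁, ih₂, writes_view, writes_view, Option.or_self]

/-- The footstep `(s, t)` of the buffer of `x` is justified by the occurrences in `A`. -/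
structure BufStep (P : Pom (TSOAct Loc V)) (x : Loc) (A : Set P.Occ) (s t : Option (BufVal V)) :
    Prop where
  bufs_eq_zero : t = none → bufs P x A = 0
  eq_none : s = none → t = none
  run : ∀ β, Compat s β → BufRun P x A β (t.getD β)

theorem BufStep.seq [Finite P.Occ] {x : Loc} {A₁ A₂ : Set P.Occ}
    (hlt : ∀ a ∈ A₁, ∀ b ∈ A₂, P.lt a b) {σ₁ τ₁ σ₂ τ₂ : BState Loc V}
    (hc : (σ₁.update τ₁).Consistent σ₂)
    (h₁ : BufStep P x A₁ (σ₁.buf.toFun x) (τ₁.buf.toFun x))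
    (h₂ : BufStep P x A₂ (σ₂.buf.toFun x) (τ₂.buf.toFun x)) :
    BufStep P x (A₁ ∪ A₂) ((σ₁.union (σ₂.diff τ₁)).buf.toFun x) ((τ₁.update τ₂).buf.toFun x) := by
  simp only [BState.union, BState.diff, BState.update, FinPart.union_apply, FinPart.diff_apply,
    FinPart.update_apply]
  refine ⟨fun h => ?_, fun h => ?_, fun β hβ => ?_⟩
  · rw [Option.or_eq_none_iff] at h
    rw [bufs_union (disjoint_of_lt hlt), h₁.bufs_eq_zero h.2, h₂.bufs_eq_zero h.1]
  · rw [Option.or_eq_none_iff] at h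
    have ht₁ := h₁.eq_none h.1
    rw [if_pos ht₁] at h
    rw [ht₁, h₂.eq_none h.2]
    rfl
  · obtain ⟨hβ₁, hβ₂⟩ := Compat.of_seq (fun p q hp hq => hc.1.eq
      (by simpa only [BState.update, FinPart.update_apply] using hp) hq) hβ
    rw [or_getD]
    exact (h₁.run β hβ₁).trans hlt (h₂.run _ hβ₂)

theorem BState.EmptyBuf.count {σ : BState Loc V} (h : σ.EmptyBuf) {x : Loc} {β : BufVal V}
    (hβ : σ.buf.toFun x = some β) : β.count = 0 := by
  obtain ⟨v, hv⟩ := h x (by simp [FinPart.dom, hβ])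
  rw [hβ, Option.some.injEq] at hv
  rw [hv, count_bufVal]

theorem BufStep.par [Finite P.Occ] {x : Loc} {A₁ A₂ : Set P.Occ} (hd : Disjoint A₁ A₂)
    {σ₁ τ₁ σ₂ τ₂ : BState Loc V} (hσ₁ : σ₁.EmptyBuf) (hτ₁ : τ₁.EmptyBuf) (hσ₂ : σ₂.EmptyBuf)
    (hτ₂ : τ₂.EmptyBuf) (hc : σ₁.Consistent σ₂)
    (h₁ : BufStep P x A₁ (σ₁.buf.toFun x) (τ₁.buf.toFun x))
    (h₂ : BufStep P x A₂ (σ₂.buf.toFun x) (τ₂.buf.toFun x)) :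
    BufStep P x (A₁ ∪ A₂) ((σ₁.union σ₂).buf.toFun x) ((τ₁.union τ₂).buf.toFun x) := by
  simp only [BState.union, FinPart.union_apply]
  refine ⟨fun h => ?_, fun h => ?_, fun β hβ => ?_⟩
  · rw [Option.or_eq_none_iff] at h
    rw [bufs_union hd, h₁.bufs_eq_zero h.1, h₂.bufs_eq_zero h.2]
  · rw [Option.or_eq_none_iff] at h
    rw [h₁.eq_none h.1, h₂.eq_none h.2]
    rfl
  · obtain ⟨hβ₁, hβ₂⟩ := Compat.of_par (fun p q hp hq => hc.1.eq hp hq) hβ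
    have c₁ := (h₁.run β hβ₁).count
    have c₂ := (h₂.run β hβ₂).count
    -- A side that changes the buffer of `x` also requires a value for it, and that value must be
    -- empty by `EmptyBuf`.
    have key : ∀ {σ τ : BState Loc V} {A : Set P.Occ},
        BufStep P x A (σ.buf.toFun x) (τ.buf.toFun x) → σ.EmptyBuf →
        Compat (σ.buf.toFun x) β → τ.buf.toFun x ≠ none → β.count = 0 := by
      intro σ τ A h hσ hβ ht
      obtain ⟨p, hp⟩ := Option.ne_none_iff_exists'.1 fun hs => ht (h.eq_none hs)
      rw [← hβ p hp]
      exact hσ.count hp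
    have fin : ∀ {τ : BState Loc V}, τ.EmptyBuf → β.count = 0 →
        ((τ.buf.toFun x).getD β).count = 0 := by
      intro τ hτ h0
      cases ht : τ.buf.toFun x with
      | none => exact h0
      | some p => exact hτ.count ht
    -- With an empty start both sides end empty and only counts matter. With a non-empty start
    -- neither side can affect the buffer of `x`.
    by_cases h0 : β.count = 0
    · have f₁ := fin hτ₁ h0
      have f₂ := fin hτ₂ h0
      have f : (((τ₁.buf.toFun x).or (τ₂.buf.toFun x)).getD β).count = 0 := by
        cases ht : τ₁.buf.toFun x with
        | none => exact f₂
        | some p => exact hτ₁.count ht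
      exact ⟨by rw [bufs_union hd, globs_union hd]; omega, .inl f⟩
    · have t₁ : τ₁.buf.toFun x = none := by_contra fun ht => h0 (key h₁ hσ₁ hβ₁ ht)
      have t₂ : τ₂.buf.toFun x = none := by_contra fun ht => h0 (key h₂ hσ₂ hβ₂ ht)
      rw [t₁] at c₁
      rw [t₂] at c₂
      simp only [Option.getD_none] at c₁ c₂
      rw [t₁, t₂]
      refine ⟨by rw [bufs_union hd, globs_union hd]; simp; omega, .inr (.inl ⟨?_, fun _ h => h⟩)⟩
      rw [bufs_union hd, h₁.bufs_eq_zero t₁, h₂.bufs_eq_zero t₂]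

theorem sep_singleton_ncard (a : P.Occ) (p : P.Occ → Prop) [Decidable (p a)] :
    {c ∈ ({a} : Set P.Occ) | p c}.ncard = if p a then 1 else 0 := by
  split_ifs with h
  · rw [show {c ∈ ({a} : Set P.Occ) | p c} = {a} by ext c; simp; rintro rfl; exact h]
    simp
  · rw [show {c ∈ ({a} : Set P.Occ) | p c} = ∅ by ext c; simp; rintro rfl; exact h]
    simp

open Classical in
theorem bufs_singleton (x : Loc) (a : P.Occ) :
    bufs P x {a} = if BufTo P x a then 1 else 0 := sep_singleton_ncard a _

open Classical in
theorem globs_singleton (x : Loc) (a : P.Occ) :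
    globs P x {a} = if GlobTo P x a then 1 else 0 := sep_singleton_ncard a _

theorem BufStep.of_no_writes {x : Loc} {a : P.Occ} (hb : ¬ BufTo P x a) (hg : ¬ GlobTo P x a)
    (s : Option (BufVal V)) : BufStep P x {a} s none :=
  ⟨fun _ => by simp [bufs_singleton, hb], fun _ => rfl, fun β _ =>
    ⟨by simp [bufs_singleton, globs_singleton, hb, hg],
      .inr (.inl ⟨by simp [bufs_singleton, hb], fun _ h => h⟩)⟩⟩

theorem BufStep.act (x : Loc) {a : P.Occ} {σ τ : BState Loc V}
    (h : (σ, τ) ∈ actFoot (P.label a)) :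
    BufStep P x {a} (σ.buf.toFun x) (τ.buf.toFun x) := by
  rcases hl : P.label a with (⟨y, v⟩ | ⟨y, v⟩ | _) | ⟨y, v⟩ <;> rw [hl] at h
  · obtain ⟨v', v'', n, h⟩ := h
    cases h
    have hb : ¬ BufTo P x a := by simp [BufTo, hl]
    by_cases hxy : x = y
    · subst hxy
      have hg : GlobTo P x a := ⟨v, hl⟩
      refine ⟨by simp [FinPart.single_apply], by simp [FinPart.single_apply], fun β hβ => ?_⟩
      obtain rfl := hβ (bufVal v'' (n + 1)) (by simp [FinPart.single_apply])
      refine ⟨by simp [FinPart.single_apply, bufs_singleton, globs_singleton, hb, hg], ?_⟩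
      refine .inr (.inl ⟨by simp [bufs_singleton, hb], fun u hu => ?_⟩)
      simp only [count_bufVal, bufVal_eq_iff] at hu
      simp [FinPart.single_apply, bufVal_eq_iff]
      simpa using Or.inl hu
    · have hg : ¬ GlobTo P x a := by
        rintro ⟨u, hu⟩
        simp_all
      simpa [FinPart.single_apply, hxy] using BufStep.of_no_writes hb hg none
  · have hb : ¬ BufTo P x a := by simp [BufTo, hl]
    have hg : ¬ GlobTo P x a := by simp [GlobTo, hl]
    rcases h with h | ⟨n, h⟩ <;> cases h <;> exact BufStep.of_no_writes hb hg _
  · have hb : ¬ BufTo P x a := by simp [BufTo, hl]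
    have hg : ¬ GlobTo P x a := by simp [GlobTo, hl]
    cases h
    exact BufStep.of_no_writes hb hg _
  · obtain ⟨v', n, h⟩ := h
    cases h
    have hg : ¬ GlobTo P x a := by simp [GlobTo, hl]
    by_cases hxy : x = y
    · subst hxy
      have hb : BufTo P x a := ⟨v, hl⟩
      refine ⟨by simp [FinPart.single_apply], by simp [FinPart.single_apply], fun β hβ => ?_⟩
      obtain rfl := hβ (bufVal v' n) (by simp [FinPart.single_apply])
      refine ⟨by simp [FinPart.single_apply, bufs_singleton, globs_singleton, hb, hg], ?_⟩
      exact .inr (.inr ⟨a, rfl, v, hl, by simp [FinPart.single_apply], fun b' hb' _ => .inl hb'⟩)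
    · have hb : ¬ BufTo P x a := by
        rintro ⟨u, hu⟩
        simp_all
      simpa [FinPart.single_apply, hxy] using BufStep.of_no_writes hb hg none

theorem FootOn.bufStep [Finite P.Occ] {A : Set P.Occ} {Λ : Env P} {σ τ : BState Loc V}
    (h : FootOn P A Λ σ τ) (x : Loc) : BufStep P x A (σ.buf.toFun x) (τ.buf.toFun x) := by
  induction h with
  | act a E₁ E₂ σ τ h =>
    obtain ⟨σ₀, τ₀, h₀, hx⟩ := actFoot_env h
    rw [(hx x).1, (hx x).2.1]
    exact .act x h₀
  | seq A₁ A₂ Λ₁ Λ₂ σ₁ τ₁ σ₂ τ₂ hlt _ _ _ _ hc ih₁ ih₂ => exact .seq hlt hc ih₁ ih₂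
  | par A₁ A₂ Λ σ₁ τ₁ σ₂ τ₂ hi _ _ _ h₁ h₂ h₃ h₄ hc ih₁ ih₂ =>
    exact .par (disjoint_of_incomp hi) h₁ h₂ h₃ h₄ hc ih₁ ih₂

end Invariants

/-! ### Reads -/

section Reads

variable {Loc V : Type*} {P : Pom (TSOAct Loc V)} {ω : BufOcc P ≃ GlobOcc P}

/-- At `r`, the environment `Λ` started in `σ` has the value `v` for `x` in the memory. -/
def MemRead (P : Pom (TSOAct Loc V)) (x : Loc) (v : V) (Λ : Env P) (σ : BState Loc V)
    (r : P.Occ) : Prop :=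
  ∃ Λ₁ Λ₂, Λ = Λ₁ ++ Sum.inl r :: Λ₂ ∧ (lastVal x (writes P Λ₁)).or (σ.mem.toFun x) = some v

theorem MemRead.seq_left {x : Loc} {v : V} {Λ₁ Λ₂ : Env P} {σ₁ : BState Loc V} {r : P.Occ}
    (h : MemRead P x v Λ₁ σ₁ r) (τ₁ σ₂ : BState Loc V) :
    MemRead P x v (Λ₁ ++ Λ₂) (σ₁.union (σ₂.diff τ₁)) r := by
  obtain ⟨E₁, E₂, rfl, h⟩ := h
  refine ⟨E₁, E₂ ++ Λ₂, by simp, ?_⟩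
  rw [BState.union, FinPart.union_apply, ← Option.or_assoc, h]
  rfl

/-- If the second part takes `v` from its own initial state, consistency forces whatever the first
part leaves or requires at `x` to be `v`. -/
theorem MemRead.seq_right {x : Loc} {v : V} {A : Set P.Occ} {Λ₁ Λ₂ : Env P}
    {σ₁ τ₁ σ₂ : BState Loc V} {r : P.Occ} (h : MemRead P x v Λ₂ σ₂ r) (h₁ : FootOn P A Λ₁ σ₁ τ₁)
    (hc : (σ₁.update τ₁).Consistent σ₂) :
    MemRead P x v (Λ₁ ++ Λ₂) (σ₁.union (σ₂.diff τ₁)) r := by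
  obtain ⟨E₁, E₂, rfl, h⟩ := h
  refine ⟨Λ₁ ++ E₁, E₂, by simp, ?_⟩
  rw [writes_append, lastVal_append, ← h₁.mem_eq_lastVal]
  simp only [BState.union, BState.diff, FinPart.union_apply, FinPart.diff_apply]
  cases hE : lastVal x (writes P E₁) with
  | some u => rw [hE] at h; simpa using h
  | none =>
    rw [hE, Option.none_or] at h
    have hc' : ∀ p, (τ₁.mem.toFun x).or (σ₁.mem.toFun x) = some p → p = v := fun p hp =>
      hc.2.eq (by rw [BState.update, FinPart.update_apply, hp]) h
    clear hE
    cases ht : τ₁.mem.toFun x <;> cases hs : σ₁.mem.toFun x <;> simp_all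

theorem MemRead.of_view {x : Loc} {v : V} {A : Set P.Occ} {Λ : Env P} {σ σ' : BState Loc V}
    {r : P.Occ} (h : MemRead P x v (view P A Λ) σ r)
    (hσ : σ.mem.toFun x = some v → σ'.mem.toFun x = some v) : MemRead P x v Λ σ' r := by
  obtain ⟨E₁, E₂, heq, h⟩ := h
  obtain ⟨Λ₁, Λ₂, rfl, h₁, h₂⟩ := List.filterMap_eq_append_iff.1 heq
  obtain ⟨Λ₃, e, Λ₄, rfl, h₃, he, -⟩ := List.filterMap_eq_cons_iff.1 h₂
  have her : e = Sum.inl r := by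
    rcases e with a | w
    · simp only [viewEntry] at he
      split_ifs at he
      · simpa using he
      · split at he <;> simp at he
    · simp [viewEntry] at he
  -- The entries in `Λ₃` are those immediately before `r` that the view deletes, so they contain no
  -- global write.
  have hw : writes P (Λ₁ ++ Λ₃) = writes P E₁ := by
    rw [← writes_view P A (Λ₁ ++ Λ₃), view, List.filterMap_append, h₁,
      List.filterMap_eq_nil_iff.2 h₃, List.append_nil]
  refine ⟨Λ₁ ++ Λ₃, Λ₄, by simp [her], ?_⟩
  rw [hw]
  cases hE : lastVal x (writes P E₁) with
  | some u => rw [hE] at h; simpa using h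
  | none => rw [hE] at h; exact hσ h

/-- The occurrence `r` of `A` is comparable to all others, and the buffer value of `x` that results
from those below `r` satisfies `p`, if they start with the requirement `s`. -/
def OpenRead (P : Pom (TSOAct Loc V)) (x : Loc) (p : BufVal V → Prop) (A : Set P.Occ)
    (s : Option (BufVal V)) (r : P.Occ) : Prop :=
  (∀ a ∈ A, a ≠ r → P.lt a r ∨ P.lt r a) ∧
    ∀ β, Compat s β → ∃ β', BufRun P x {a ∈ A | P.lt a r} β β' ∧ p β'

theorem OpenRead.seq_left {x : Loc} {p : BufVal V → Prop} {A₁ A₂ : Set P.Occ}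
    (hlt : ∀ a ∈ A₁, ∀ b ∈ A₂, P.lt a b) {σ₁ τ₁ σ₂ : BState Loc V}
    (hc : (σ₁.update τ₁).Consistent σ₂) {r : P.Occ} (hr : r ∈ A₁)
    (h : OpenRead P x p A₁ (σ₁.buf.toFun x) r) :
    OpenRead P x p (A₁ ∪ A₂) ((σ₁.union (σ₂.diff τ₁)).buf.toFun x) r := by
  refine ⟨?_, fun β hβ => ?_⟩
  · rintro a (ha | ha) hne
    · exact h.1 a ha hne
    · exact .inr (hlt r hr a ha)
  · simp only [BState.union, BState.diff, FinPart.union_apply, FinPart.diff_apply] at hβ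
    obtain ⟨hβ₁, -⟩ := Compat.of_seq (fun p q hp hq => hc.1.eq
      (by simpa only [BState.update, FinPart.update_apply] using hp) hq) hβ
    have : {a ∈ A₁ ∪ A₂ | P.lt a r} = {a ∈ A₁ | P.lt a r} := by
      ext a
      refine ⟨fun ⟨ha, har⟩ => ⟨ha.resolve_right fun ha => ?_, har⟩, fun ha => ⟨.inl ha.1, ha.2⟩⟩
      exact P.irrefl _ (P.trans _ _ _ har (hlt r hr a ha))
    rw [this]
    exact h.2 β hβ₁

/-- All of `A₁` now lies below `r`, so its run is put in front of the run recorded so far. -/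
theorem OpenRead.seq_right [Finite P.Occ] {x : Loc} {p : BufVal V → Prop} {A₁ A₂ : Set P.Occ}
    (hlt : ∀ a ∈ A₁, ∀ b ∈ A₂, P.lt a b) {σ₁ τ₁ σ₂ : BState Loc V}
    (hc : (σ₁.update τ₁).Consistent σ₂) {r : P.Occ} (hr : r ∈ A₂)
    (h₁ : BufStep P x A₁ (σ₁.buf.toFun x) (τ₁.buf.toFun x))
    (h : OpenRead P x p A₂ (σ₂.buf.toFun x) r) :
    OpenRead P x p (A₁ ∪ A₂) ((σ₁.union (σ₂.diff τ₁)).buf.toFun x) r := by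
  refine ⟨?_, fun β hβ => ?_⟩
  · rintro a (ha | ha) hne
    · exact .inl (hlt a ha r hr)
    · exact h.1 a ha hne
  · simp only [BState.union, BState.diff, FinPart.union_apply, FinPart.diff_apply] at hβ
    obtain ⟨hβ₁, hβ₂⟩ := Compat.of_seq (fun p q hp hq => hc.1.eq
      (by simpa only [BState.update, FinPart.update_apply] using hp) hq) hβ
    have : {a ∈ A₁ ∪ A₂ | P.lt a r} = A₁ ∪ {a ∈ A₂ | P.lt a r} := by
      ext a
      constructor
      · rintro ⟨ha | ha, har⟩
        · exact .inl ha
        · exact .inr ⟨ha, har⟩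
      · rintro (ha | ha)
        · exact ⟨.inl ha, hlt a ha r hr⟩
        · exact ⟨.inr ha.1, ha.2⟩
    rw [this]
    obtain ⟨β', hrun, hp⟩ := h.2 _ hβ₂
    exact ⟨β', (h₁.run β hβ₁).trans (fun a ha b hb => hlt a ha b hb.1) hrun, hp⟩

theorem BState.EmptyBuf.exists_compat [Nonempty V] {σ : BState Loc V} (h : σ.EmptyBuf) (x : Loc) :
    ∃ β, Compat (σ.buf.toFun x) β ∧ β.count = 0 := by
  cases hs : σ.buf.toFun x with
  -- Without a requirement at `x`, any empty buffer value will do as start.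
  | none => exact ⟨bufVal (Classical.arbitrary V) 0, by simp [Compat], rfl⟩
  | some β => exact ⟨β, by simp [Compat], h.count hs⟩

theorem OpenRead.flushed [Finite P.Occ] [Nonempty V] (hbal : IsBalancing P ω) {x : Loc}
    {A : Set P.Occ} (hA : ComponentClosed P A) {σ : BState Loc V} (hσ : σ.EmptyBuf) {r : P.Occ}
    (hr : r ∈ A) (h : OpenRead P x (fun β => β.count = 0) A (σ.buf.toFun x) r) :
    Flushed P ω x r := by
  obtain ⟨β, hβ, h0⟩ := hσ.exists_compat x
  obtain ⟨β', hrun, h0'⟩ := h.2 β hβ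
  have := hrun.count
  exact hbal.flushed hA hr (by omega)

/-- The buffer is not empty, and its most recent value is `v`. -/
def Pending (v : V) (β : BufVal V) : Prop := β = bufVal v β.count ∧ β.count ≠ 0

theorem OpenRead.forwarded [Finite P.Occ] (hbal : IsBalancing P ω) {x : Loc} {v : V}
    {A : Set P.Occ} (hA : ComponentClosed P A) (hmod : IsModule P A) {σ : BState Loc V}
    (hσ : σ.EmptyBuf) {r : P.Occ} (hr : r ∈ A) (hread : P.label r = .po (.read x v))
    (h : OpenRead P x (Pending v) A (σ.buf.toFun x) r) : Forwarded P ω x v r := by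
  have : Nonempty V := ⟨v⟩
  obtain ⟨β, hβ, h0⟩ := hσ.exists_compat x
  obtain ⟨β', hrun, hv, hne⟩ := h.2 β hβ
  have hcount := hrun.count
  rcases hrun.value with h' | ⟨h', -⟩ | ⟨b, ⟨hbA, hbr⟩, u, hbl, hu, hmax⟩
  · exact absurd h' hne
  -- Starting empty and without buffer writes, the buffer cannot be non-empty at `r`.
  · omega
  · obtain rfl : v = u := by
      rw [hv, count_bufVal, bufVal_eq_iff] at hu
      exact hu.2.resolve_right hne
    exact hbal.forwarded hA hmod hr (by rw [hread]; rfl) h.1 (by omega) hbA hbr hbl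
      fun b' hb'A hb'r => hmax b' ⟨hb'A, hb'r⟩

/-- The `OpenRead` alternatives record that no parallel node has been met yet above the read; the
first such node replaces them by `Flushed` or `Forwarded`, which speak of the whole pomset and
persist. -/
theorem FootOn.read [Finite P.Occ] (hbal : IsBalancing P ω) {A : Set P.Occ} {Λ : Env P}
    {σ τ : BState Loc V} (h : FootOn P A Λ σ τ) (hmod : IsModule P A) {r : P.Occ} {x : Loc} {v : V}
    (hr : r ∈ A) (hread : P.label r = .po (.read x v)) :
    (MemRead P x v Λ σ r ∧
      (Flushed P ω x r ∨ OpenRead P x (fun β => β.count = 0) A (σ.buf.toFun x) r)) ∨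
    Forwarded P ω x v r ∨ OpenRead P x (Pending v) A (σ.buf.toFun x) r := by
  have : Nonempty V := ⟨v⟩
  induction h with
  | act a E₁ E₂ σ τ h =>
    obtain rfl : r = a := hr
    obtain ⟨σ₀, τ₀, h₀, hx⟩ := actFoot_env h
    obtain ⟨hb, -, -, hm⟩ := hx x
    rw [hread] at h₀
    -- At the leaf nothing lies below the read, and its footstep fixes the buffer value exactly.
    have key : ∀ {p : BufVal V → Prop} {β}, σ₀.buf.toFun x = some β → p β →
        OpenRead P x p {r} (σ.buf.toFun x) r := by
      intro p β hs hp
      refine ⟨fun a ha hne => absurd ha hne, fun β' hβ' => ?_⟩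
      obtain rfl := hβ' β (hb.trans hs)
      refine ⟨β, ?_, hp⟩
      have : {a ∈ ({r} : Set P.Occ) | P.lt a r} = ∅ := by
        ext a
        simp only [Set.mem_singleton_iff, Set.mem_empty_iff_false, iff_false]
        rintro ⟨rfl, h⟩
        exact P.irrefl _ h
      rw [this]
      exact .empty β
    rcases h₀ with h₀ | ⟨n, h₀⟩
    · cases h₀
      refine .inl ⟨⟨E₁.map Sum.inr, E₂.map Sum.inr, by simp, ?_⟩, .inr
        (key (β := bufVal v 0) (by simp [FinPart.single_apply]) rfl)⟩
      rw [writes_map_inr]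
      exact hm v (by simp [FinPart.single_apply])
    · cases h₀
      exact .inr (.inr (key (β := bufVal v (n + 1)) (by simp [FinPart.single_apply])
        ⟨rfl, by simp⟩))
  | seq A₁ A₂ Λ₁ Λ₂ σ₁ τ₁ σ₂ τ₂ hlt _ _ h₁ h₂ hc ih₁ ih₂ =>
    rcases hr with hr | hr
    · rcases ih₁ (hmod.left_of_lt hlt) hr with ⟨hm, h⟩ | h
      · exact .inl ⟨hm.seq_left τ₁ σ₂, h.imp_right (·.seq_left hlt hc hr)⟩
      · exact .inr (h.imp_right (·.seq_left hlt hc hr))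
    · rcases ih₂ (hmod.right_of_lt hlt) hr with ⟨hm, h⟩ | h
      · exact .inl ⟨hm.seq_right h₁ hc, h.imp_right (·.seq_right hlt hc hr (h₁.bufStep x))⟩
      · exact .inr (h.imp_right (·.seq_right hlt hc hr (h₁.bufStep x)))
  | par A₁ A₂ Λ σ₁ τ₁ σ₂ τ₂ hi _ h₁ h₂ he₁ _ he₂ _ hc ih₁ ih₂ =>
    have hi' : ∀ a ∈ A₂, ∀ b ∈ A₁, P.Incomp a b := fun a ha b hb => incomp_symm (hi b hb a ha)
    have hmod' : IsModule P (A₂ ∪ A₁) := Set.union_comm A₁ A₂ ▸ hmod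
    rcases hr with hr | hr
    -- The component starts with empty buffers and is closed under SP components, so the counting
    -- arguments apply.
    · have hA := ComponentClosed.of_incomp hmod h₂.nonempty hi
      have hm₁ := hmod.left_of_incomp hi
      rcases ih₁ hm₁ hr with ⟨hm, h⟩ | h
      · refine .inl ⟨hm.of_view fun hs => ?_, .inl (h.elim id (·.flushed hbal hA he₁ hr))⟩
        rw [BState.union, FinPart.union_apply, hs]
        rfl
      · exact .inr (.inl (h.elim id (·.forwarded hbal hA hm₁ he₁ hr hread)))
    · have hA := ComponentClosed.of_incomp hmod' h₁.nonempty hi'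
      have hm₂ := hmod'.left_of_incomp hi'
      rcases ih₂ hm₂ hr with ⟨hm, h⟩ | h
      · refine .inl ⟨hm.of_view fun hs => ?_, .inl (h.elim id (·.flushed hbal hA he₂ hr))⟩
        rw [BState.union, FinPart.union_apply]
        cases hs₁ : σ₁.mem.toFun x with
        | none => exact hs
        | some u => rw [hc.2.eq hs₁ hs]; rfl
      · exact .inr (.inl (h.elim id (·.forwarded hbal hA hm₂ he₂ hr hread)))

theorem read_of_mem_zfoot [Finite P.Occ] (hbal : IsBalancing P ω) {Λ : List P.Occ}
    {σ τ : BState Loc V} (h : (σ, τ) ∈ zfoot P Λ) {r : P.Occ} {x : Loc} {v : V}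
    (hread : P.label r = .po (.read x v)) :
    (MemRead P x v (Λ.map Sum.inl) σ r ∧ Flushed P ω x r) ∨ Forwarded P ω x v r := by
  obtain ⟨hfoot, hσ, -⟩ := h
  have : Nonempty V := ⟨v⟩
  have hA : ComponentClosed P Set.univ := fun _ _ _ _ _ => Set.subset_univ _
  have hmod : IsModule P Set.univ := fun c hc => absurd (Set.mem_univ c) hc
  rcases hfoot.read hbal hmod (Set.mem_univ r) hread with ⟨hm, h⟩ | h
  · exact .inl ⟨hm, h.elim id (·.flushed hbal hA hσ trivial)⟩
  · exact .inr (h.elim id (·.forwarded hbal hA hmod hσ trivial hread))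

end Reads

/-! ### Lists as orders -/

section Precedes

variable {α β : Type*} {l : List α} {a b : α}

theorem precedes_iff_append :
    Precedes l a b ↔ ∃ l₁ l₂, l = l₁ ++ l₂ ∧ a ∈ l₁ ∧ b ∈ l₂ := by
  rw [Precedes, show [a, b] = [a] ++ [b] from rfl, List.append_sublist_iff]
  simp only [List.singleton_sublist]

open Classical in
theorem precedes_iff_idxOf (hl : l.Nodup) :
    Precedes l a b ↔ b ∈ l ∧ l.idxOf a < l.idxOf b := by
  constructor
  · rw [precedes_iff_append]
    rintro ⟨l₁, l₂, rfl, ha, hb⟩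
    have hb₁ : b ∉ l₁ := fun h => (List.nodup_append.1 hl).2.2 b h b hb rfl
    refine ⟨by simp [hb], ?_⟩
    rw [List.idxOf_append_of_mem ha, List.idxOf_append_of_notMem hb₁]
    have := List.idxOf_lt_length_iff.2 ha
    omega
  · rintro ⟨hb, hlt⟩
    obtain ⟨s, t, rfl⟩ := List.append_of_mem hb
    have hbs : b ∉ s := fun h => (List.nodup_append.1 hl).2.2 b h b (by simp) rfl
    refine precedes_iff_append.2 ⟨s, b :: t, rfl, ?_, by simp⟩
    by_contra ha
    rw [List.idxOf_append_of_notMem ha, List.idxOf_append_of_notMem hbs] at hlt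
    simp at hlt

theorem Pom.Enumerates.isStrictOrder (hl : Enumerates l) : IsStrictOrder α (Precedes l) where
  irrefl a h := by
    classical
    exact lt_irrefl _ ((precedes_iff_idxOf hl.1).1 h).2
  trans a b c h h' := by
    classical
    rw [precedes_iff_idxOf hl.1] at *
    exact ⟨h'.1, h.2.trans h'.2⟩

theorem Pom.Enumerates.total (hl : Enumerates l) (hab : a ≠ b) : Precedes l a b ∨ Precedes l b a := by
  classical
  simp only [precedes_iff_idxOf hl.1, hl.2, true_and]
  exact lt_or_gt_of_ne fun h => hab ((List.idxOf_inj (hl.2 a)).1 h)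

theorem Pom.Enumerates.not_precedes_symm (hl : Enumerates l) (h : Precedes l a b) :
    ¬ Precedes l b a := fun h' =>
  have := hl.isStrictOrder
  irrefl_of (Precedes l) a (trans_of (Precedes l) h h')

theorem precedes_append_cons_iff {l₁ l₂ : List α} (hl : Enumerates (l₁ ++ b :: l₂)) :
    Precedes (l₁ ++ b :: l₂) a b ↔ a ∈ l₁ := by
  constructor
  · intro h
    by_contra ha
    have hmem : a ∈ b :: l₂ := (List.mem_append.1 (hl.2 a)).resolve_left ha
    rcases List.mem_cons.1 hmem with rfl | ha₂
    · have := hl.isStrictOrder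
      exact irrefl_of (Precedes _) _ h
    · exact hl.not_precedes_symm h
        (precedes_iff_append.2 ⟨l₁ ++ [b], l₂, by simp, by simp, ha₂⟩)
  · exact fun h => precedes_iff_append.2 ⟨l₁, b :: l₂, rfl, h, by simp⟩

theorem precedes_map_iff {f : α → β} (hf : f.Injective) :
    Precedes (l.map f) (f a) (f b) ↔ Precedes l a b := by
  refine ⟨fun h => ?_, fun h => List.Sublist.map f h⟩
  obtain ⟨l', hl', heq⟩ := List.sublist_map_iff.1 h
  obtain rfl := List.map_injective_iff.2 hf (a₁ := [a, b]) heq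
  exact hl'

theorem precedes_filter_iff {p : α → Bool} (ha : p a = true) (hb : p b = true) :
    Precedes (l.filter p) a b ↔ Precedes l a b := by
  refine ⟨fun h => List.Sublist.trans h List.filter_sublist, fun h => ?_⟩
  have := List.Sublist.filter p h
  rwa [List.filter_cons_of_pos ha, List.filter_cons_of_pos hb, List.filter_nil] at this

end Precedes

/-! ### Identification of the occurrences of the underlying program order -/

section Rep

variable {Loc V : Type*} {P : Pom (TSOAct Loc V)} {ω : BufOcc P ≃ GlobOcc P}

theorem rep_of_isBuf {u : (U P).Occ} (h : (P.label u.1).isBuf = true) :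
    rep P ω u = (ω ⟨u.1, h⟩).1 := dif_pos h

theorem rep_of_not_isBuf {u : (U P).Occ} (h : ¬ (P.label u.1).isBuf = true) :
    rep P ω u = u.1 := dif_neg h

theorem rep_injective : Function.Injective (rep P ω) := by
  intro u u' he
  by_cases h : (P.label u.1).isBuf = true <;> by_cases h' : (P.label u'.1).isBuf = true
  · rw [rep_of_isBuf h, rep_of_isBuf h'] at he
    exact Subtype.ext (by simpa using ω.injective (Subtype.ext he))
  · rw [rep_of_isBuf h, rep_of_not_isBuf h'] at he
    exact absurd (he ▸ (ω ⟨u.1, h⟩).2) u'.2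
  · rw [rep_of_not_isBuf h, rep_of_isBuf h'] at he
    exact absurd (he ▸ (ω ⟨u'.1, h'⟩).2) u.2
  · rw [rep_of_not_isBuf h, rep_of_not_isBuf h'] at he
    exact Subtype.ext he

theorem TSOAct.isPO_eq_not_isBuf (l : TSOAct Loc V) : l.isPO = !l.isBuf := by cases l <;> rfl

theorem TSOAct.not_isGlob_of_isBuf {l : TSOAct Loc V} (h : l.isBuf = true) :
    ¬ l.isGlob = true := by
  cases l with
  | po l => cases h
  | bufWrite x v => simp [TSOAct.isGlob]

/-- A global write represents the buffer write that `ω` matches with it; with injectivity, `rep` is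
a bijection onto the program-order occurrences. -/
theorem exists_rep_eq {a : P.Occ} (h : (P.label a).isPO = true) : ∃ u, rep P ω u = a := by
  by_cases hg : (P.label a).isGlob = true
  · let u : (U P).Occ := ⟨(ω.symm ⟨a, hg⟩).1, TSOAct.not_isGlob_of_isBuf (ω.symm ⟨a, hg⟩).2⟩
    refine ⟨u, (rep_of_isBuf (u := u) (ω.symm ⟨a, hg⟩).2).trans ?_⟩
    simp [u]
  · refine ⟨⟨a, hg⟩, rep_of_not_isBuf ?_⟩
    rw [TSOAct.isPO_eq_not_isBuf] at h
    simpa using h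

theorem IsBalancing.label_rep (h : IsBalancing P ω) (u : (U P).Occ) :
    P.label (rep P ω u) = .po ((U P).label u) := by
  by_cases hb : (P.label u.1).isBuf = true
  · rw [rep_of_isBuf hb]
    rcases hl : P.label u.1 with l | ⟨x, v⟩
    · rw [hl] at hb; cases hb
    · rw [h.label_glob hl]
      simp [U, hl, TSOAct.toPO]
  · rw [rep_of_not_isBuf hb]
    rcases hl : P.label u.1 with l | ⟨x, v⟩
    · simp [U, hl, TSOAct.toPO]
    · rw [hl] at hb; exact absurd rfl hb

theorem IsBalancing.lt_rep (h : IsBalancing P ω) {a : P.Occ} {u : (U P).Occ} (hlt : P.lt a u.1) :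
    P.lt a (rep P ω u) := by
  by_cases hb : (P.label u.1).isBuf = true
  · rw [rep_of_isBuf hb]
    exact P.trans _ _ _ hlt (h.below ⟨u.1, hb⟩)
  · rwa [rep_of_not_isBuf hb]

theorem label_of_write {u : (U P).Occ} {x : Loc} {v : V}
    (h : (U P).label u = .write x v) : P.label u.1 = .bufWrite x v := by
  have hg := u.2
  rcases hl : P.label u.1 with l | ⟨y, w⟩
  · rw [hl] at hg
    simp only [U, hl, TSOAct.toPO] at h
    subst h
    exact absurd rfl hg
  · simpa [U, hl, TSOAct.toPO] using h

theorem label_of_read {u : (U P).Occ} {x : Loc} {v : V}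
    (h : (U P).label u = .read x v) : P.label u.1 = .po (.read x v) := by
  rcases hl : P.label u.1 with l | ⟨y, w⟩
  · simp only [U, hl, TSOAct.toPO] at h
    rw [h]
  · simp [U, hl, TSOAct.toPO] at h

theorem rep_of_read {u : (U P).Occ} {x : Loc} {v : V} (h : (U P).label u = .read x v) :
    rep P ω u = u.1 :=
  rep_of_not_isBuf (by rw [label_of_read h]; simp [TSOAct.isBuf])

end Rep

/-! ### Consistency of the order of representatives -/

section Soundness

variable {Loc V : Type*} {P : Pom (TSOAct Loc V)} {ω : BufOcc P ≃ GlobOcc P}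

/-- The order on the underlying program order that a list of occurrences induces. -/
def RepLt (P : Pom (TSOAct Loc V)) (ω : BufOcc P ≃ GlobOcc P) (Λ : List P.Occ) (u w : (U P).Occ) :
    Prop := Precedes Λ (rep P ω u) (rep P ω w)

theorem exists_last_write {x : Loc} {v : V} {Λ : List P.Occ}
    (h : lastVal x (writes P (Λ.map Sum.inl)) = some v) :
    ∃ l₁ g l₂, Λ = l₁ ++ g :: l₂ ∧ P.label g = .po (.write x v) ∧ ∀ a ∈ l₂, ¬ GlobTo P x a := by
  obtain ⟨E₁, E₂, heq, hE₂⟩ := lastVal_eq_some h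
  rw [writes, List.filterMap_map] at heq
  obtain ⟨l₁, l₂, rfl, -, h₂⟩ := List.filterMap_eq_append_iff.1 heq
  obtain ⟨l₃, g, l₄, rfl, -, hg, h₄⟩ := List.filterMap_eq_cons_iff.1 h₂
  refine ⟨l₁ ++ l₃, g, l₄, by simp, ?_, ?_⟩
  · simp only [Function.comp, writeEntry] at hg
    split at hg <;> simp_all
  · rintro a ha ⟨u, hu⟩
    refine lastVal_eq_none hE₂ u ?_
    rw [← h₄, List.mem_filterMap]
    exact ⟨a, ha, by simp [writeEntry, hu]⟩

theorem not_globTo_of_lastVal {x : Loc} {Λ : List P.Occ}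
    (h : lastVal x (writes P (Λ.map Sum.inl)) = none) : ∀ a ∈ Λ, ¬ GlobTo P x a := by
  rintro a ha ⟨u, hu⟩
  refine lastVal_eq_none h u ?_
  rw [writes, List.filterMap_map, List.mem_filterMap]
  exact ⟨a, ha, by simp [writeEntry, hu]⟩

theorem mem_writesBelow_of_read {Q : Pom (POAct Loc V)} {lt : Q.Occ → Q.Occ → Prop} {x y : Loc}
    {v : V} {r w : Q.Occ} (hr : Q.label r = .read y v) :
    w ∈ writesBelow Q lt x r ↔ (Q.label w).IsWriteTo x ∧ lt w r := by
  refine ⟨fun ⟨hw, h⟩ => ⟨hw, h.resolve_right ?_⟩, fun ⟨hw, h⟩ => ⟨hw, .inl h⟩⟩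
  rintro rfl
  obtain ⟨u, hu⟩ := id hw
  rw [hr] at hu
  cases hu

theorem tsoConsistentFrom_U (hbal : IsBalancing P ω) {Λ : List P.Occ} (hΛ : Λ ∈ P.Lin)
    {σ τ : BState Loc V} (hfoot : (σ, τ) ∈ zfoot P Λ) :
    TSOConsistentFrom σ.mem (U P) (RepLt P ω Λ) := by
  obtain ⟨henum, hlin⟩ := hΛ
  have : Finite P.Occ := (Set.finite_univ_iff.1 ((List.finite_toSet Λ).subset fun a _ => henum.2 a))
  have hstrict := henum.isStrictOrder
  -- The target needs no care, since `rep` moves it upwards; only a source that is a buffer write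
  -- needs its global write to stay below the target.
  have hlt : ∀ {u w : (U P).Occ}, P.lt u.1 w.1 →
      (∀ h : (P.label u.1).isBuf = true, P.lt (ω ⟨u.1, h⟩).1 w.1) → RepLt P ω Λ u w := by
    intro u w huw h
    refine hlin _ _ (hbal.lt_rep ?_)
    by_cases hb : (P.label u.1).isBuf = true
    · rw [rep_of_isBuf hb]; exact h hb
    · rwa [rep_of_not_isBuf hb]
  have hglob : ∀ {u : (U P).Occ} {x : Loc}, ((U P).label u).IsWriteTo x →
      GlobTo P x (rep P ω u) := by
    rintro u x ⟨v, hv⟩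
    exact ⟨v, by rw [hbal.label_rep, hv]⟩
  refine ⟨{ irrefl := ?_, trans := ?_ }, ?_, ?_, ?_, ?_, ?_, ?_⟩
  · exact fun u h => hstrict.irrefl _ h
  · exact fun u w z h h' => hstrict.trans _ _ _ h h'
  · exact fun u w _ _ hne => henum.total fun h => hne (rep_injective h)
  · intro r x v hr
    have hrep : rep P ω r = r.1 := rep_of_read hr
    rcases read_of_mem_zfoot hbal hfoot (label_of_read hr) with ⟨⟨Λ₁', Λ₂', heq, hval⟩, hflush⟩ | hfwd
    · obtain ⟨Λ₁, Λ₂, hΛeq, rfl, h₂⟩ := List.map_eq_append_iff.1 heq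
      obtain ⟨r', Λ₃, rfl, hr', -⟩ := List.map_eq_cons_iff.1 h₂
      obtain rfl := Sum.inl_injective hr'
      have hprec : ∀ a, Precedes Λ a r.1 ↔ a ∈ Λ₁ := fun a => by
        rw [hΛeq] at henum ⊢
        exact precedes_append_cons_iff henum
      -- Flushing puts the writes below the read in program order before it in the list, as V(a) and
      -- V(c) demand.
      have hbelow : ∀ w ∈ writesBelow (U P) (U P).lt x r, rep P ω w ∈ Λ₁ := by
        intro w hw
        obtain ⟨⟨u, hu⟩, hwr⟩ := (mem_writesBelow_of_read hr).1 hw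
        have hwb := label_of_write hu
        have hbuf : BufTo P x w.1 := ⟨u, hwb⟩
        rw [rep_of_isBuf hbuf.isBuf, ← hprec]
        exact hlin _ _ (hflush ⟨w.1, hbuf.isBuf⟩ hbuf hwr)
      have hbelow' : ∀ w ∈ writesBelow (U P) (RepLt P ω Λ) x r, rep P ω w ∈ Λ₁ := by
        intro w hw
        have := ((mem_writesBelow_of_read hr).1 hw).2
        rw [RepLt, hrep] at this
        exact (hprec _).1 this
      cases hlast : lastVal x (writes P (Λ₁.map Sum.inl)) with
      | none =>
        have hno := not_globTo_of_lastVal hlast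
        rw [hlast] at hval
        refine .inr (.inr ⟨?_, ?_, hval⟩)
        · exact Set.eq_empty_of_forall_notMem fun w hw => hno _ (hbelow' w hw) (hglob hw.1)
        · exact Set.eq_empty_of_forall_notMem fun w hw => hno _ (hbelow w hw) (hglob hw.1)
      | some v' =>
        obtain rfl : v' = v := by rw [hlast] at hval; simpa using hval
        obtain ⟨l₁, g, l₂, rfl, hg, hl₂⟩ := exists_last_write hlast
        obtain ⟨w, rfl⟩ := exists_rep_eq (ω := ω) (a := g) (by rw [hg]; rfl)
        have hw : (U P).label w = .write x v' := by
          have := hbal.label_rep w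
          rw [hg] at this
          simpa using this.symm
        have hlast' : ∀ u, GlobTo P x (rep P ω u) → rep P ω u ∈ l₁ ++ rep P ω w :: l₂ →
            u = w ∨ RepLt P ω Λ u w := by
          intro u hu hmem
          rcases List.mem_append.1 hmem with h | h
          · right
            rw [RepLt, hΛeq]
            exact precedes_iff_append.2 ⟨l₁, rep P ω w :: l₂ ++ r.1 :: Λ₃, by simp, h, by simp⟩
          · rcases List.mem_cons.1 h with h | h
            · exact .inl (rep_injective h)
            · exact absurd hu (hl₂ _ h)
        refine .inl ⟨w, v', hw, ⟨(mem_writesBelow_of_read hr).2 ⟨⟨v', hw⟩, ?_⟩, ?_⟩, ?_, rfl⟩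
        · rw [RepLt, hrep, hprec]
          simp
        · intro u hu hwu
          rcases hlast' u (hglob hu.1) (hbelow' u hu) with rfl | h
          · exact hstrict.irrefl _ hwu
          · exact henum.not_precedes_symm h hwu
        · intro u hu
          rcases hlast' u (hglob hu.1) (hbelow u hu) with rfl | h
          · exact .inr rfl
          · exact .inl h
    -- A forwarded read satisfies V(b), witnessed by the write that stems from the pending buffer
    -- write.
    · obtain ⟨b, hb, hbr, hrb, hmax⟩ := hfwd
      let w : (U P).Occ := ⟨b.1, TSOAct.not_isGlob_of_isBuf b.2⟩
      have hw : (U P).label w = .write x v := by simp [U, w, hb, TSOAct.toPO]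
      refine .inr (.inl ⟨w, v, hw, ⟨(mem_writesBelow_of_read hr).2 ⟨⟨v, hw⟩, hbr⟩, ?_⟩, ?_, rfl⟩)
      · intro u hu
        obtain ⟨⟨v', hv'⟩, hur⟩ := (mem_writesBelow_of_read hr).1 hu
        exact hmax u.1 ⟨v', label_of_write hv'⟩ hur
      · rw [RepLt, hrep, rep_of_isBuf (u := w) b.2]
        exact hlin _ _ hrb
  · rintro r a ⟨x, v, hr⟩ hra
    refine hlt hra fun hb => ?_
    rw [label_of_read hr] at hb
    cases hb
  · rintro w w' ⟨x, v, hw⟩ ⟨x', v', hw'⟩ hww'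
    have hb : BufTo P x w.1 := ⟨v, label_of_write hw⟩
    have hb' : BufTo P x' w'.1 := ⟨v', label_of_write hw'⟩
    rw [RepLt, rep_of_isBuf hb.isBuf, rep_of_isBuf hb'.isBuf]
    exact hlin _ _ (hbal.glob_lt_glob (b := ⟨w.1, hb.isBuf⟩) (b' := ⟨w'.1, hb'.isBuf⟩) hww')
  · intro a b c hab hac hi
    have hbc : P.Incomp b.1 c.1 := ⟨fun h => hi.1 (Subtype.ext h), hi.2⟩
    exact ⟨hlt hab fun hb => hbal.glob_lt_of_fork (b := ⟨a.1, hb⟩) hab hac hbc,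
      hlt hac fun hb => hbal.glob_lt_of_fork (b := ⟨a.1, hb⟩) hac hab (incomp_symm hbc)⟩
  · intro a b c hac hbc hi
    have hab : P.Incomp a.1 b.1 := ⟨fun h => hi.1 (Subtype.ext h), hi.2⟩
    exact ⟨hlt hac fun hb => hbal.glob_lt_of_join (b := ⟨a.1, hb⟩) hac hbc hab,
      hlt hbc fun hb => hbal.glob_lt_of_join (b := ⟨b.1, hb⟩) hbc hac (incomp_symm hab)⟩

theorem IsMaxIn.map_equiv {α β : Type*} (e : α ≃ β) {lt : α → α → Prop} {lt' : β → β → Prop}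
    (h : ∀ a b, lt' (e a) (e b) ↔ lt a b) {S : Set α} {S' : Set β} (hS : ∀ a, e a ∈ S' ↔ a ∈ S)
    {a : α} (ha : IsMaxIn lt S a) : IsMaxIn lt' S' (e a) :=
  ⟨(hS a).2 ha.1, fun b hb hlt => by
    obtain ⟨b, rfl⟩ := e.surjective b
    exact ha.2 b ((hS b).1 hb) ((h a b).1 hlt)⟩

/-- TSO-consistency is invariant under isomorphism. -/
theorem TSOConsistentFrom.map_iso {σ : FinPart Loc V} {Q R : Pom (POAct Loc V)} (φ : Iso Q R)
    {T : Q.Occ → Q.Occ → Prop} {T' : R.Occ → R.Occ → Prop}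
    (hT : ∀ a b, T' (φ.toEquiv a) (φ.toEquiv b) ↔ T a b) (h : TSOConsistentFrom σ Q T) :
    TSOConsistentFrom σ R T' := by
  have hW : ∀ {lt : Q.Occ → Q.Occ → Prop} {lt' : R.Occ → R.Occ → Prop},
      (∀ a b, lt' (φ.toEquiv a) (φ.toEquiv b) ↔ lt a b) → ∀ x r a,
      φ.toEquiv a ∈ writesBelow R lt' x (φ.toEquiv r) ↔ a ∈ writesBelow Q lt x r := by
    intro lt lt' hlt x r a
    simp [writesBelow, lowerClosure, hlt, φ.label_eq]
  have hempty : ∀ {S : Set Q.Occ} {S' : Set R.Occ}, (∀ a, φ.toEquiv a ∈ S' ↔ a ∈ S) →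
      S = ∅ → S' = ∅ := by
    rintro S S' hS rfl
    refine Set.eq_empty_of_forall_notMem fun b hb => ?_
    obtain ⟨a, rfl⟩ := φ.toEquiv.surjective b
    exact (hS a).1 hb
  have hI : ∀ a b, R.Incomp (φ.toEquiv a) (φ.toEquiv b) ↔ Q.Incomp a b := fun a b => by
    simp [Pom.Incomp, φ.lt_iff]
  have hs := h.strict
  refine ⟨{ irrefl := ?_, trans := ?_ }, ?_, ?_, ?_, ?_, ?_, ?_⟩ <;>
    simp only [φ.toEquiv.surjective.forall, hT, φ.lt_iff, φ.label_eq, hI]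
  · exact hs.irrefl
  · exact hs.trans
  · exact fun w w' hw hw' hne => h.ordering w w' hw hw' fun he => hne (he ▸ rfl)
  · intro r x v hr
    rcases h.value r x v hr with ⟨w, v', hw, hmax, hsub, hv⟩ | ⟨w, v', hw, hmax, hrw, hv⟩ |
        ⟨h₁, h₂, h₃⟩
    · refine .inl ⟨φ.toEquiv w, v', by rw [φ.label_eq, hw], hmax.map_equiv _ hT (hW hT x r), ?_, hv⟩
      intro b hb
      obtain ⟨a, rfl⟩ := φ.toEquiv.surjective b
      exact (hsub ((hW φ.lt_iff x r a).1 hb)).imp (hT a w).2 (congrArg φ.toEquiv)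
    · exact .inr (.inl ⟨φ.toEquiv w, v', by rw [φ.label_eq, hw],
        hmax.map_equiv _ φ.lt_iff (hW φ.lt_iff x r), (hT r w).2 hrw, hv⟩)
    · exact .inr (.inr ⟨hempty (hW hT x r) h₁, hempty (hW φ.lt_iff x r) h₂, h₃⟩)
  · exact h.loadOp
  · exact h.storeStore
  · exact h.fork
  · exact h.join

/-- Every list in `𝒯 Q` enumerates `Q` and is TSO-consistent with it. -/
theorem enumerates_and_tsoConsistent_of_mem_𝒯 {Q : Pom (POAct Loc V)} {L : List Q.Occ}
    (hL : L ∈ 𝒯 Q) : Enumerates L ∧ TSOConsistent Q (Precedes L) := by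
  obtain ⟨P, ω, φ, Λ, -, hbal, hΛ, ⟨⟨σ, τ⟩, hfoot⟩, hmap⟩ := hL
  have hinj : Function.Injective fun p => rep P ω (φ.toEquiv.symm p) :=
    rep_injective.comp φ.toEquiv.symm.injective
  have hPO : ∀ u, (P.label (rep P ω u)).isPO = true := fun u => by rw [hbal.label_rep]; rfl
  -- The images of `L` under the injection `rep` are the program-order part of `Λ`, so both the
  -- enumeration property and the order can be pulled back from `Λ`.
  refine ⟨⟨.of_map _ (hmap ▸ hΛ.1.1.filter _), fun p => ?_⟩, σ.mem,
    (tsoConsistentFrom_U hbal hΛ hfoot).map_iso φ fun a b => ?_⟩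
  · refine (List.mem_map_of_injective hinj).1 ?_
    rw [hmap]
    exact List.mem_filter.2 ⟨hΛ.1.2 _, hPO _⟩
  · rw [← precedes_map_iff hinj, hmap, precedes_filter_iff (p := fun a => (P.label a).isPO) (hPO _) (hPO _)]
    simp [RepLt]

end Soundness

end TSO

theorem mainTheorem1 (Loc V : Type*) :
    TSO.Sound (TSO.𝒯 : (P : TSO.Pom (TSO.POAct Loc V)) → Set (List P.Occ)) := by
  intro _ _ _ _ L hL
  exact TSO.enumerates_and_tsoConsistent_of_mem_𝒯 hL
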